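/- **Definitions.** Let $A\subset\mathbb{R}^d$. For a family of sets $\mathcal C=\{C_v\mid v\in V\}$, its nerve is the abstract simplicial complex of all nonempty finite $\sigma\subset V$ with $\bigcap_{v\in\sigma}C_v\neq\emptyset$. For an abstract simplicial complex $T$, $|T|$ denotes its underlying space. The underlying space of a simplex $\sigma$ is the closed simplex in $|T|$ spanned by its vertices, and $\operatorname{St}(v,T)\subset|T|$ is the union of the closed simplices of $T$ that contain the vertex $v$. Let $X^{\oplus\delta}=\bigcup_{x\in X}B(x,\delta)$ be the union of the closed balls of radius $\delta$ centred in $X$, and let $\operatorname{Conv}$ denote the convex hull. For $\rho,\delta>0$, a simplicial complex $T$ with vertex set $V$ is a *$(\rho,\delta)$-nice triangulation of $A$* with respect to $(h,\mathcal C)$ if $h:|T|\to A$ is a homeomorphism, $\mathcal C=\{C_v\mid v\in V\}$ is a locally finite covering of $A$ by compact subsets of $A$ (so a finite covering if $A$ is compact), the nerve of $\mathcal C$ is $T$, and 1. $h(\sigma)\subset\bigcup_{v\in\sigma}C_v$ for all simplices $\sigma\in T$; 2. $C_v$ is contained in the open ball of centre $h(v)$ and radius $\rho$, for all $v\in V$;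 3. $A\cap[\operatorname{Conv}C_v]^{\oplus\delta}\subset h(\operatorname{St}(v,T))$ for all $v\in V$. $A$ is *nicely triangulable* if there are $\rho_0>0$ and $\eta_0>0$ such that for every $0<\rho<\rho_0$ there is a $(\rho,\eta_0\rho)$-nice triangulation of $A$ (with respect to some $(h,\mathcal C)$). **Theorem.** The following embedded manifolds are nicely triangulable: 1. the unit 2-sphere $\{x\in\mathbb{R}^3\mid x_1^2+x_2^2+x_3^2=1\}$; 2. the flat torus $\{x\in\mathbb{R}^4\mid x_1^2+x_2^2=1 \text{ and } x_3^2+x_4^2=1\}$; 3. the $m$-dimensional Euclidean space $\mathbb{R}^m$ embedded in $\mathbb{R}^d$, for all $0\le m\le d$; that is, the image of any affine isometric embedding $\mathbb{R}^m\to\mathbb{R}^d$. -/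

import Mathlib

open Set Topology

/-- The nerve of a family of sets: all nonempty finite sets of indices whose
members have a common point. -/
def familyNerve {V E : Type*} (C : V → Set E) : PreAbstractSimplicialComplex V where
  faces := {s | s.Nonempty ∧ (⋂ v ∈ s, C v).Nonempty}
  isRelLowerSet_faces := by
    rintro s ⟨hs, x, hx⟩
    refine ⟨hs, fun t hts ht => ⟨ht, x, ?_⟩⟩
    simp only [mem_iInter] at hx ⊢
    exact fun v hv => hx v (hts hv)

/-- The underlying space `|T|` of an abstract simplicial complex: formal convex combinations
`x` of vertices (`x v` is the barycentric coordinate at `v`) whose support is a simplex. -/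
def UnderlyingSpace {V : Type*} (T : AbstractSimplicialComplex V) : Type _ :=
  {x : V →₀ ℝ // (∀ v, 0 ≤ x v) ∧ x.support ∈ T.faces ∧ x.sum (fun _ a => a) = 1}

namespace UnderlyingSpace

variable {V : Type*} (T : AbstractSimplicialComplex V)

/-- The closed simplex of `|T|` spanned by the vertices in `s`. -/
def closedSimplex (s : Finset V) : Set (UnderlyingSpace T) := {x | x.1.support ⊆ s}

/-- A closed simplex carries its Euclidean topology, that is, the topology of
convergence of the barycentric coordinates. -/
@[reducible] def simplexTopology (s : Finset V) : TopologicalSpace (closedSimplex T s) :=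
  TopologicalSpace.induced (fun x => (fun v => x.1.1 v : V → ℝ)) inferInstance

/-- `|T|` carries the coherent (weak) topology: a set is open if and only if its trace on
every closed simplex is open in that simplex. -/
instance : TopologicalSpace (UnderlyingSpace T) :=
  ⨆ s : {s : Finset V // s ∈ T.faces},
    TopologicalSpace.coinduced (Subtype.val : closedSimplex T s.1 → UnderlyingSpace T)
      (simplexTopology T s.1)

theorem isOpen_iff (U : Set (UnderlyingSpace T)) :
    IsOpen U ↔ ∀ s ∈ T.faces, IsOpen[simplexTopology T s]
      (Subtype.val ⁻¹' U : Set (closedSimplex T s)) := by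
  refine isOpen_iSup_iff.trans ?_
  simp only [isOpen_coinduced, Subtype.forall]

/-- The vertex `v`, as a point of `|T|`. -/
noncomputable def vertex (v : V) : UnderlyingSpace T :=
  ⟨Finsupp.single v 1, by
    classical
    refine ⟨fun w => ?_, ?_, by simp⟩
    · rw [Finsupp.single_apply]
      split_ifs <;> norm_num
    · rw [show (Finsupp.single v (1 : ℝ)).support = {v} by ext w; simp [Finsupp.single_apply, eq_comm]]
      exact T.singleton_mem v⟩

/-- The star of `v`: the union of all closed simplices of `T` incident to `v`. -/
def star (v : V) : Set (UnderlyingSpace T) :=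
  ⋃ s ∈ {s : Finset V | s ∈ T.faces ∧ v ∈ s}, closedSimplex T s

end UnderlyingSpace

/-- The `δ`-offset of `X`: the union of the closed balls of radius `δ` centred in `X`. -/
def offset {d : ℕ} (X : Set (EuclideanSpace ℝ (Fin d))) (δ : ℝ) :
    Set (EuclideanSpace ℝ (Fin d)) :=
  ⋃ x ∈ X, Metric.closedBall x δ

/-- `T` is a `(ρ, δ)`-nice triangulation of `A` with respect to the homeomorphism
`h : |T| → A` and the compact covering `C` of `A`. The covering is required to be locally
finite; when `A` is compact this means that it is finite, see
`IsNiceTriangulation.locallyFinite_iff_finite`. -/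
structure IsNiceTriangulation {d : ℕ} (A : Set (EuclideanSpace ℝ (Fin d))) (ρ δ : ℝ)
    {V : Type*} (T : AbstractSimplicialComplex V) (h : UnderlyingSpace T ≃ₜ A)
    (C : V → Set (EuclideanSpace ℝ (Fin d))) : Prop where
  rho_pos : 0 < ρ
  delta_pos : 0 < δ
  isCompact : ∀ v, IsCompact (C v)
  iUnion_eq : ⋃ v, C v = A
  locallyFinite : LocallyFinite C
  nerve_eq : familyNerve C = T.toPreAbstractSimplicialComplex
  simplex_subset : ∀ s ∈ T.faces,
    (fun x => (h x : EuclideanSpace ℝ (Fin d))) '' UnderlyingSpace.closedSimplex T s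
      ⊆ ⋃ v ∈ s, C v
  cell_subset_ball : ∀ v,
    C v ⊆ Metric.ball (h (UnderlyingSpace.vertex T v) : EuclideanSpace ℝ (Fin d)) ρ
  offset_subset_star : ∀ v,
    A ∩ offset (convexHull ℝ (C v)) δ
      ⊆ (fun x => (h x : EuclideanSpace ℝ (Fin d))) '' UnderlyingSpace.star T v

/-- For a covering of a compact set whose nerve has every index as a vertex, local
finiteness is the same as finiteness. -/
theorem IsNiceTriangulation.locallyFinite_iff_finite {d : ℕ}
    {A : Set (EuclideanSpace ℝ (Fin d))} (hA : IsCompact A) {V : Type*}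
    (T : AbstractSimplicialComplex V) (C : V → Set (EuclideanSpace ℝ (Fin d)))
    (hC : ⋃ v, C v = A) (hT : familyNerve C = T.toPreAbstractSimplicialComplex) :
    LocallyFinite C ↔ Finite V := by
  refine ⟨fun hf => ?_, fun _ => locallyFinite_of_finite C⟩
  have hne : ∀ v, (C v ∩ A).Nonempty := fun v => by
    have hv : {v} ∈ (familyNerve C).faces := by
      rw [hT]
      exact T.singleton_mem v
    obtain ⟨x, hx⟩ := hv.2
    have hx' : x ∈ C v := by simpa using hx
    exact ⟨x, hx', hC ▸ mem_iUnion_of_mem v hx'⟩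
  have hfin := hf.finite_nonempty_inter_compact hA
  rw [show {v | (C v ∩ A).Nonempty} = univ from eq_univ_of_forall hne] at hfin
  exact finite_univ_iff.mp hfin

/-- `A` is nicely triangulable: for some `ρ₀, η₀ > 0` there is a `(ρ, η₀ ρ)`-nice
triangulation of `A` for every `0 < ρ < ρ₀`. -/
def IsNicelyTriangulable {d : ℕ} (A : Set (EuclideanSpace ℝ (Fin d))) : Prop :=
  ∃ ρ₀ > (0 : ℝ), ∃ η₀ > (0 : ℝ), ∀ ρ : ℝ, 0 < ρ → ρ < ρ₀ →
    ∃ (V : Type) (T : AbstractSimplicialComplex V) (h : UnderlyingSpace T ≃ₜ A)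
      (C : V → Set (EuclideanSpace ℝ (Fin d))), IsNiceTriangulation A ρ (η₀ * ρ) T h C

/-! Each space carries a triangulation of mesh comparable to `ρ`, described through its barycentric
coordinates `lam v`, a partition of unity by tent functions. The covering consists of the cells on
which a given coordinate is largest. The cells of a set of vertices have a common point exactly when
these vertices span a simplex, its barycentre being such a point; so the nerve is the triangulation
itself. Condition 1 holds because the largest coordinate of a point of a simplex belongs to one of
its vertices, and condition 2 because the tents are small.

Condition 3 is the quantitative one. At most `N` coordinates are nonzero and they sum to one, so
`lam v ≥ 1 / N` on the cell of `v`: the cell lies well inside the open star `lam v > 0`. To pass to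
the convex hull in the ambient space, the star is enclosed by concave functions on all of `ℝ^d`,
bounded below by `c` on the cell, hence on its hull, and `L`-Lipschitz, hence still positive on the
`δ`-offset when `L * δ < c`. Since `L` grows like `1 / ρ`, `δ` can be a fixed multiple of `ρ`. This
is `TentFamily.isNiceTriangulation`; the rest constructs tents and concave functions.

For `ℝ^m` the triangulation is Kuhn's triangulation of the integer lattice. The tent at `w` is `1 -
spread (y - w)` cut off at zero, and its value is the probability that rounding `y + θ` down gives
`w`, for `θ` uniform in `[0, 1)`. Total mass one and expectation `y` follow at once. The concave
function is the tent before the cut-off, composed with the orthogonal projection.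

For the sphere, the faces of an octahedron of size `n` carry the planar Kuhn triangulation,
projected radially; half the `ℓ¹` norm restricts to `spread` on each face, so one formula serves all
octants. The concave functions cut out the cone over a star. For the flat torus, the planar Kuhn
triangulation is taken modulo `n` in the two angles; replacing angles by their sines makes the
functions extend concavely to `ℝ^4`, with a cubic error, and positive cosines exclude the far side
of the circle. -/

/-- A locally finite, continuous partition of unity on `A` which identifies `A` with the underlying
space of a simplicial complex: the values separate points, and any prescribed weights on a set of
vertices that are simultaneously positive somewhere are attained. -/
structure TentFamily {d : ℕ} (A : Set (EuclideanSpace ℝ (Fin d))) {V : Type}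
    (lam : V → EuclideanSpace ℝ (Fin d) → ℝ) (N : ℕ) : Prop where
  isClosed : IsClosed A
  continuousOn : ∀ v, ContinuousOn (lam v) A
  nonneg : ∀ v, ∀ x ∈ A, 0 ≤ lam v x
  locallyFinite : LocallyFinite fun v => {x ∈ A | 0 < lam v x}
  partition : ∀ x ∈ A, ∃ S : Finset V, S.card ≤ N ∧ (∀ v ∉ S, lam v x = 0) ∧ ∑ v ∈ S, lam v x = 1
  separates : ∀ x ∈ A, ∀ y ∈ A, (∀ v, lam v x = lam v y) → x = y
  realize : ∀ s : Finset V, ∀ x₀ ∈ A, (∀ v ∈ s, 0 < lam v x₀) → ∀ t : V → ℝ, (∀ v, 0 ≤ t v) →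
    ∑ v ∈ s, t v = 1 → ∃ x ∈ A, ∀ v ∈ s, t v ≤ lam v x
  peak : ∀ v, ∃ x ∈ A, lam v x = 1
  isBounded : ∀ v, Bornology.IsBounded {x ∈ A | 0 < lam v x}

/-! ### Tent families and the nice triangulations they define -/

namespace TentFamily

variable {d : ℕ} {A : Set (EuclideanSpace ℝ (Fin d))} {V : Type}
  {lam : V → EuclideanSpace ℝ (Fin d) → ℝ} {N : ℕ}

/-- The points of `A` at which the tent function of `v` is maximal. -/
def cell (A : Set (EuclideanSpace ℝ (Fin d))) (lam : V → EuclideanSpace ℝ (Fin d) → ℝ) (v : V) :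
    Set (EuclideanSpace ℝ (Fin d)) :=
  {x ∈ A | ∀ w, lam w x ≤ lam v x}

theorem support_finite (H : TentFamily A lam N) {x : EuclideanSpace ℝ (Fin d)} (hx : x ∈ A) :
    (Function.support fun v => lam v x).Finite := by
  obtain ⟨S, -, hS, -⟩ := H.partition x hx
  refine S.finite_toSet.subset fun v hv => ?_
  by_contra h
  exact hv (hS v h)

theorem sum_eq_one (H : TentFamily A lam N) {x : EuclideanSpace ℝ (Fin d)} (hx : x ∈ A)
    {s : Finset V} (hs : ∀ v ∉ s, lam v x = 0) : ∑ v ∈ s, lam v x = 1 := by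
  classical
  obtain ⟨S, -, hS, h1⟩ := H.partition x hx
  rw [← h1, Finset.sum_subset (s₁ := s) (s₂ := s ∪ S) Finset.subset_union_left
    fun v _ hv => hs v hv, Finset.sum_subset (s₁ := S) (s₂ := s ∪ S) Finset.subset_union_right
    fun v _ hv => hS v hv]

/-- Both families have total mass one, so lower bounds on `s` leave no room for excess. This is why
`realize` need only supply inequalities. -/
theorem eq_of_le (H : TentFamily A lam N) {x : EuclideanSpace ℝ (Fin d)} (hx : x ∈ A)
    {s : Finset V} {t : V → ℝ} (ht1 : ∑ v ∈ s, t v = 1)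
    (hle : ∀ v ∈ s, t v ≤ lam v x) :
    (∀ v ∈ s, lam v x = t v) ∧ ∀ v ∉ s, lam v x = 0 := by
  classical
  obtain ⟨S, -, hS, h1⟩ := H.partition x hx
  have hu : ∑ v ∈ s ∪ S, lam v x = 1 := H.sum_eq_one hx fun v hv => hS v fun h =>
    hv (Finset.mem_union_right _ h)
  have hs_le : ∑ v ∈ s, lam v x ≤ 1 := hu ▸ Finset.sum_le_sum_of_subset_of_nonneg
    Finset.subset_union_left fun v _ _ => H.nonneg v x hx
  have hs_eq : ∑ v ∈ s, t v = ∑ v ∈ s, lam v x :=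
    le_antisymm (Finset.sum_le_sum hle) (ht1 ▸ hs_le)
  refine ⟨fun v hv => ((Finset.sum_eq_sum_iff_of_le hle).1 hs_eq v hv).symm, fun v hv => ?_⟩
  have h0 : ∑ v ∈ (s ∪ S) \ s, lam v x = 0 := by
    have := Finset.sum_sdiff (f := fun v => lam v x) (Finset.subset_union_left (s₁ := s) (s₂ := S))
    linarith
  by_cases hvS : v ∈ S
  · exact (Finset.sum_eq_zero_iff_of_nonneg fun v _ => H.nonneg v x hx).1 h0 v (by simp [hv, hvS])
  · exact hS v hvS

/-- The largest of at most `N` nonnegative numbers with sum one is at least their average. This is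
the margin between a cell and the boundary of the star. -/
theorem exists_inv_le (H : TentFamily A lam N) {x : EuclideanSpace ℝ (Fin d)} (hx : x ∈ A) :
    ∃ v, 1 / (N : ℝ) ≤ lam v x ∧ ∀ w, lam w x ≤ lam v x := by
  obtain ⟨S, hN, hS, h1⟩ := H.partition x hx
  have hne : S.Nonempty := by
    rw [Finset.nonempty_iff_ne_empty]
    rintro rfl
    simp at h1
  obtain ⟨v, hv, hmax⟩ := S.exists_max_image (fun v => lam v x) hne
  have hmax' : ∀ w, lam w x ≤ lam v x := fun w => by
    by_cases hw : w ∈ S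
    · exact hmax w hw
    · rw [hS w hw]; exact H.nonneg v x hx
  refine ⟨v, ?_, hmax'⟩
  have h2 : (1 : ℝ) ≤ S.card * lam v x := by
    rw [← h1, ← nsmul_eq_mul]
    exact Finset.sum_le_card_nsmul _ _ _ fun w hw => hmax w hw
  have hNpos : (0 : ℝ) < N := by
    have : 0 < N := hne.card_pos.trans_le hN
    exact_mod_cast this
  rw [div_le_iff₀ hNpos]
  have h3 : (S.card : ℝ) ≤ N := by exact_mod_cast hN
  nlinarith [H.nonneg v x hx]

theorem inv_le_of_mem_cell (H : TentFamily A lam N) {x : EuclideanSpace ℝ (Fin d)} {v : V}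
    (hx : x ∈ cell A lam v) : 1 / (N : ℝ) ≤ lam v x := by
  obtain ⟨w, hw, -⟩ := H.exists_inv_le hx.1
  exact hw.trans (hx.2 w)

theorem pos_of_mem_cell (H : TentFamily A lam N) {x : EuclideanSpace ℝ (Fin d)} {v : V}
    (hx : x ∈ cell A lam v) : 0 < lam v x := by
  obtain ⟨S, -, hS, h1⟩ := H.partition x hx.1
  by_contra! h
  have : ∑ w ∈ S, lam w x = 0 := Finset.sum_eq_zero fun w _ =>
    le_antisymm ((hx.2 w).trans h) (H.nonneg w x hx.1)
  linarith

/-- The cells and the larger open supports have the same nerve: where the tents of `s` are all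
positive somewhere, `realize` with equal weights yields a barycentre, which lies in every cell of
`s`. -/
theorem mem_familyNerve_iff (H : TentFamily A lam N) (s : Finset V) :
    s ∈ (familyNerve (cell A lam)).faces ↔ s.Nonempty ∧ ∃ x ∈ A, ∀ v ∈ s, 0 < lam v x := by
  constructor
  · rintro ⟨hs, x, hx⟩
    simp only [mem_iInter] at hx
    obtain ⟨v, hv⟩ := hs
    exact ⟨⟨v, hv⟩, x, (hx v hv).1, fun w hw => H.pos_of_mem_cell (hx w hw)⟩
  · rintro ⟨hs, x₀, hx₀, hpos⟩
    have hc : (0 : ℝ) < s.card := by exact_mod_cast hs.card_pos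
    have hsum : ∑ v ∈ s, (fun _ => 1 / (s.card : ℝ)) v = 1 := by simp [hc.ne']
    obtain ⟨x, hx, hle⟩ := H.realize s x₀ hx₀ hpos (fun _ => 1 / (s.card : ℝ))
      (fun _ => by positivity) hsum
    obtain ⟨h1, h2⟩ := H.eq_of_le hx hsum hle
    refine ⟨hs, x, ?_⟩
    simp only [mem_iInter]
    refine fun v hv => ⟨hx, fun w => ?_⟩
    by_cases hw : w ∈ s
    · rw [h1 v hv, h1 w hw]
    · rw [h2 w hw]; exact H.nonneg v x hx

/-- The nerve of the cells of a tent family, with all indices as vertices. -/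
def complex (H : TentFamily A lam N) : AbstractSimplicialComplex V where
  toPreAbstractSimplicialComplex := familyNerve (cell A lam)
  singleton_mem v := by
    obtain ⟨x, hx, h1⟩ := H.peak v
    refine (H.mem_familyNerve_iff {v}).2 ⟨by simp, x, hx, by simp [h1]⟩

/-- The values of the tent functions at a point, as barycentric coordinates. -/
noncomputable def coords (H : TentFamily A lam N) (x : A) : UnderlyingSpace H.complex :=
  ⟨Finsupp.ofSupportFinite (fun v => lam v x) (H.support_finite x.2), fun v => H.nonneg v x x.2, by
    refine (H.mem_familyNerve_iff _).2 ⟨?_, x, x.2, fun v hv => ?_⟩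
    · obtain ⟨S, -, hS, h1⟩ := H.partition x x.2
      by_contra! h
      have h0 : ∀ v, lam v x = 0 := fun v => by
        have : v ∉ (Finsupp.ofSupportFinite (fun v => lam v x) (H.support_finite x.2)).support := by
          simp [h]
        simpa [Finsupp.ofSupportFinite_coe] using this
      simp [h0] at h1
    · exact (H.nonneg v x x.2).lt_of_ne (by simpa [Finsupp.ofSupportFinite_coe, eq_comm] using hv),
    H.sum_eq_one x.2 fun v hv => by simpa [Finsupp.ofSupportFinite_coe] using hv⟩

theorem coords_apply (H : TentFamily A lam N) (x : A) (v : V) : (H.coords x).1 v = lam v x := rfl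

theorem coords_bijective (H : TentFamily A lam N) : Function.Bijective H.coords := by
  constructor
  · intro x y hxy
    refine Subtype.ext (H.separates x x.2 y y.2 fun v => ?_)
    rw [← H.coords_apply, ← H.coords_apply, hxy]
  · rintro ⟨t, ht0, hts, ht1⟩
    obtain ⟨-, x₀, hx₀, hpos⟩ := (H.mem_familyNerve_iff _).1 hts
    obtain ⟨x, hx, hle⟩ := H.realize t.support x₀ hx₀ hpos t ht0 ht1
    obtain ⟨h1, h2⟩ := H.eq_of_le hx ht1 hle
    refine ⟨⟨x, hx⟩, Subtype.ext (Finsupp.ext fun v => ?_)⟩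
    rw [coords_apply]
    by_cases hv : v ∈ t.support
    · exact h1 v hv
    · rw [h2 v hv, Finsupp.notMem_support_iff.1 hv]

theorem coords_mem_closedSimplex_iff (H : TentFamily A lam N) (x : A) (s : Finset V) :
    H.coords x ∈ UnderlyingSpace.closedSimplex H.complex s ↔ ∀ v ∉ s, lam v x = 0 := by
  change (H.coords x).1.support ⊆ s ↔ _
  simp only [Finset.subset_iff, Finsupp.mem_support_iff, coords_apply]
  exact forall_congr' fun v => by tauto

theorem continuous_values (H : TentFamily A lam N) : Continuous fun (x : A) (v : V) => lam v x :=
  continuous_pi fun v => continuousOn_iff_continuous_domRestrict.1 (H.continuousOn v)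

theorem isClosed_vanishing (H : TentFamily A lam N) (s : Finset V) :
    IsClosed {x : A | ∀ v ∉ s, lam v x = 0} := by
  simp only [ofPred_forall]
  exact isClosed_iInter fun v => isClosed_iInter fun _ =>
    isClosed_eq ((continuous_apply v).comp H.continuous_values) continuous_const

/-- This is the preimage of a closed simplex. Some coordinate in `s` is positive at each of its
points, so it lies in a finite union of bounded supports. -/
theorem isCompact_vanishing (H : TentFamily A lam N) (s : Finset V) :
    IsCompact {x : A | ∀ v ∉ s, lam v x = 0} := by
  rw [Subtype.isCompact_iff]
  refine Metric.isCompact_of_isClosed_isBounded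
    (H.isClosed.isClosedEmbedding_subtypeVal.isClosedMap _ (H.isClosed_vanishing s)) ?_
  refine (((Bornology.isBounded_biUnion s.finite_toSet).2 fun v _ => H.isBounded v)).subset ?_
  rintro _ ⟨x, hx, rfl⟩
  by_contra h
  have h0 : ∀ v ∈ s, lam v x = 0 := fun v hv => by
    by_contra hne
    exact h (mem_biUnion (show v ∈ (s : Set V) from hv)
      ⟨x.2, (H.nonneg v x x.2).lt_of_ne (Ne.symm hne)⟩)
  have := H.sum_eq_one x.2 hx
  rw [Finset.sum_eq_zero h0] at this
  norm_num at this

theorem coords_continuousOn (H : TentFamily A lam N) {s : Finset V} (hs : s ∈ H.complex.faces) :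
    ContinuousOn H.coords {x : A | ∀ v ∉ s, lam v x = 0} := by
  rw [continuousOn_iff_continuous_domRestrict]
  let g : {x : A | ∀ v ∉ s, lam v x = 0} → UnderlyingSpace.closedSimplex H.complex s :=
    fun x => ⟨H.coords x.1, (H.coords_mem_closedSimplex_iff x.1 s).2 x.2⟩
  let _ := UnderlyingSpace.simplexTopology H.complex s
  have hg : Continuous g := continuous_induced_rng.2 <|
    H.continuous_values.comp continuous_subtype_val
  have hv : Continuous (Subtype.val : UnderlyingSpace.closedSimplex H.complex s →
      UnderlyingSpace H.complex) := by
    rw [continuous_iff_coinduced_le]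
    exact le_iSup (fun s : {s : Finset V // s ∈ H.complex.faces} =>
      TopologicalSpace.coinduced (Subtype.val : UnderlyingSpace.closedSimplex H.complex s.1 → _)
        (UnderlyingSpace.simplexTopology H.complex s.1)) ⟨s, hs⟩
  exact hv.comp hg

/-- Maps into the weak topology are continuous on pieces landing in one closed simplex. The closures
of the sets with fixed support are such pieces, and they form a locally finite closed cover. -/
theorem coords_continuous (H : TentFamily A lam N) : Continuous H.coords := by
  have hlf : LocallyFinite fun s : Finset V => {x : A | (H.coords x).1.support = s} := by
    intro x
    obtain ⟨U, hU, hfin⟩ := H.locallyFinite x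
    refine ⟨Subtype.val ⁻¹' U, continuous_subtype_val.continuousAt.preimage_mem_nhds hU, ?_⟩
    refine hfin.toFinset.powerset.finite_toSet.subset ?_
    rintro s ⟨y, hys, hyU⟩
    simp only [Finset.coe_powerset, mem_preimage, mem_powerset_iff]
    intro v hv
    have hv' : v ∈ (H.coords y).1.support := by
      rw [show (H.coords y).1.support = s from hys]; exact hv
    rw [Finsupp.mem_support_iff, coords_apply] at hv'
    simp only [Finite.coe_toFinset, mem_ofPred_eq]
    exact ⟨y, ⟨y.2, (H.nonneg v y y.2).lt_of_ne hv'.symm⟩, hyU⟩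
  refine hlf.closure.continuous ?_ (fun _ => isClosed_closure) fun s => ?_
  · refine eq_univ_of_forall fun x => mem_iUnion.2 ⟨(H.coords x).1.support, subset_closure rfl⟩
  · by_cases hs : s ∈ H.complex.faces
    · refine (H.coords_continuousOn hs).mono (closure_minimal ?_ (H.isClosed_vanishing s))
      intro x hx
      refine (H.coords_mem_closedSimplex_iff x s).1 ?_
      change (H.coords x).1.support ⊆ s
      rw [show (H.coords x).1.support = s from hx]
    · have : {x : A | (H.coords x).1.support = s} = ∅ := by
        refine eq_empty_of_forall_notMem fun x hx => hs ?_
        rw [← show (H.coords x).1.support = s from hx]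
        exact (H.coords x).2.2.1
      rw [this, closure_empty]
      exact continuousOn_empty _

theorem coords_isClosedMap (H : TentFamily A lam N) : IsClosedMap H.coords := by
  intro U hU
  rw [← isOpen_compl_iff, UnderlyingSpace.isOpen_iff]
  intro s _
  rw [preimage_compl]
  let _ := UnderlyingSpace.simplexTopology H.complex s
  rw [isOpen_compl_iff]
  -- The trace on a simplex is the image of a compact set under the coordinate values, hence closed
  -- in the product topology that induces the simplex topology.
  refine isClosed_induced_iff.2 ⟨(fun (x : A) (v : V) => lam v x) ''
    ({x : A | ∀ v ∉ s, lam v x = 0} ∩ U), ?_, ?_⟩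
  · exact (((H.isCompact_vanishing s).inter_right hU).image H.continuous_values).isClosed
  · ext z
    constructor
    · rintro ⟨x, ⟨-, hxU⟩, hxz⟩
      exact ⟨x, hxU, Subtype.ext (Finsupp.ext fun v => congrFun hxz v)⟩
    · rintro ⟨x, hxU, hxz⟩
      refine ⟨x, ⟨(H.coords_mem_closedSimplex_iff x s).1 (hxz ▸ z.2), hxU⟩, funext fun v => ?_⟩
      change _ = z.1.1 v
      rw [← hxz]
      rfl

/-- The homeomorphism between `A` and the nerve of the cells of a tent family. -/
noncomputable def homeomorph (H : TentFamily A lam N) : A ≃ₜ UnderlyingSpace H.complex :=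
  (Equiv.ofBijective H.coords H.coords_bijective).toHomeomorphOfContinuousClosed
    H.coords_continuous H.coords_isClosedMap

theorem homeomorph_apply (H : TentFamily A lam N) (x : A) : H.homeomorph x = H.coords x := rfl

theorem isClosed_cell (H : TentFamily A lam N) (v : V) : IsClosed (cell A lam v) := by
  have : cell A lam v = Subtype.val '' {x : A | ∀ w, lam w x ≤ lam v x} := by
    ext x
    constructor
    · exact fun hx => ⟨⟨x, hx.1⟩, hx.2, rfl⟩
    · rintro ⟨x, hx, rfl⟩
      exact ⟨x.2, hx⟩
  rw [this]
  refine H.isClosed.isClosedEmbedding_subtypeVal.isClosedMap _ ?_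
  rw [ofPred_forall]
  exact isClosed_iInter fun w => isClosed_le ((continuous_apply w).comp H.continuous_values)
    ((continuous_apply v).comp H.continuous_values)

/-- A tent family gives a nice triangulation as soon as its tents are small and, for each vertex,
there are concave Lipschitz functions that are bounded below on the cell and whose common
positivity forces a point of `A` into the open star. -/
theorem isNiceTriangulation (H : TentFamily A lam N) {ρ δ c L : ℝ} (hρ : 0 < ρ) (hδ : 0 < δ)
    (hc : L * δ < c) {κ : V → Type} (p : V → EuclideanSpace ℝ (Fin d)) (hpA : ∀ v, p v ∈ A)
    (hp : ∀ v, lam v (p v) = 1) (hball : ∀ v, ∀ x ∈ A, 0 < lam v x → dist x (p v) < ρ)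
    (G : ∀ v, κ v → EuclideanSpace ℝ (Fin d) → ℝ) (hG : ∀ v k, ConcaveOn ℝ univ (G v k))
    (hL : ∀ v k x y, G v k x - G v k y ≤ L * dist x y) (hL0 : 0 ≤ L)
    (hcell : ∀ v k, ∀ x ∈ A, 1 / (N : ℝ) ≤ lam v x → c ≤ G v k x)
    (hstar : ∀ v, ∀ x ∈ A, (∀ k, 0 < G v k x) → 0 < lam v x) :
    IsNiceTriangulation A ρ δ H.complex H.homeomorph.symm (cell A lam) where
  rho_pos := hρ
  delta_pos := hδ
  isCompact v := Metric.isCompact_of_isClosed_isBounded (H.isClosed_cell v)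
    ((H.isBounded v).subset fun x hx => ⟨hx.1, H.pos_of_mem_cell hx⟩)
  iUnion_eq := by
    refine Subset.antisymm (iUnion_subset fun v x hx => hx.1) fun x hx => ?_
    obtain ⟨v, -, hv⟩ := H.exists_inv_le hx
    exact mem_iUnion.2 ⟨v, hx, hv⟩
  locallyFinite := H.locallyFinite.subset fun v x hx => ⟨hx.1, H.pos_of_mem_cell hx⟩
  nerve_eq := rfl
  simplex_subset := by
    rintro s _ _ ⟨z, hz, rfl⟩
    obtain ⟨x, rfl⟩ := H.homeomorph.surjective z
    simp only [Homeomorph.symm_apply_apply]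
    obtain ⟨v, -, hv⟩ := H.exists_inv_le x.2
    have hvc : (x : EuclideanSpace ℝ (Fin d)) ∈ cell A lam v := ⟨x.2, hv⟩
    refine mem_biUnion (x := v) ?_ hvc
    by_contra hvs
    exact (H.pos_of_mem_cell hvc).ne' ((H.coords_mem_closedSimplex_iff x s).1 hz v hvs)
  cell_subset_ball v := by
    classical
    have hv : H.homeomorph.symm (UnderlyingSpace.vertex H.complex v) = ⟨p v, hpA v⟩ := by
      rw [Homeomorph.symm_apply_eq, homeomorph_apply]
      obtain ⟨h1, h2⟩ := H.eq_of_le (hpA v) (s := {v}) (t := fun _ => 1) (by simp) (by simp [hp])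
      refine Subtype.ext (Finsupp.ext fun w => ?_)
      rw [coords_apply]
      change Finsupp.single v (1 : ℝ) w = lam w (p v)
      by_cases hw : w = v
      · subst hw; simp [hp]
      · rw [h2 w (by simpa using hw), Finsupp.single_apply, if_neg (Ne.symm hw)]
    rw [hv]
    exact fun x hx => hball v x hx.1 (H.pos_of_mem_cell hx)
  offset_subset_star v := by
    rintro x ⟨hxA, hx⟩
    obtain ⟨y, hy, hxy⟩ := mem_iUnion₂.1 hx
    have hpos : 0 < lam v x := hstar v x hxA fun k => by
      -- Superlevel sets of concave functions are convex, so the bound `c` passes from the cell to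
      -- its hull; the Lipschitz bound then costs at most `L * δ < c`.
      have hconv : Convex ℝ {z ∈ univ | c ≤ G v k z} := (hG v k).convex_ge c
      have hsub : convexHull ℝ (cell A lam v) ⊆ {z ∈ univ | c ≤ G v k z} :=
        convexHull_min (fun z hz => ⟨mem_univ z, hcell v k z hz.1 (H.inv_le_of_mem_cell hz)⟩) hconv
      have h1 := (hsub hy).2
      have h2 := hL v k y x
      have h3 : dist y x ≤ δ := by rw [dist_comm]; exact hxy
      have h4 := mul_le_mul_of_nonneg_left h3 hL0
      linarith
    refine ⟨H.homeomorph ⟨x, hxA⟩, ?_, by simp⟩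
    refine mem_biUnion (x := (H.coords ⟨x, hxA⟩).1.support)
      ⟨(H.coords ⟨x, hxA⟩).2.2.1, ?_⟩ (Finset.Subset.refl _)
    rw [Finsupp.mem_support_iff, coords_apply]
    exact hpos.ne'

end TentFamily

/-- If the points `e v`, `v ∈ s`, are at mutual distance at most `1` for a seminorm, then the
barycentre with weights `t` is at distance at most `1 - t v` from `e v`. -/
theorem Seminorm.barycenter_sub_le {F W : Type*} [AddCommGroup F] [Module ℝ F]
    (p : Seminorm ℝ F) {s : Finset W} {t : W → ℝ} (ht : ∀ v, 0 ≤ t v) (ht1 : ∑ v ∈ s, t v = 1)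
    {e : W → F} (he : ∀ v ∈ s, ∀ w ∈ s, p (e w - e v) ≤ 1) {v : W} (hv : v ∈ s) :
    p (∑ w ∈ s, t w • e w - e v) ≤ 1 - t v := by
  classical
  have h1 : ∑ w ∈ s, t w • e w - e v = ∑ w ∈ s, t w • (e w - e v) := by
    simp only [smul_sub, Finset.sum_sub_distrib, ← Finset.sum_smul, ht1, one_smul]
  rw [h1, ← Finset.add_sum_erase _ _ hv, sub_self, smul_zero, zero_add, ← ht1,
    ← Finset.add_sum_erase _ _ hv, add_sub_cancel_left]
  refine (Finset.le_sum_of_subadditive p (map_zero p).le (map_add_le_add p) _ _).trans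
    (Finset.sum_le_sum fun w hw => ?_)
  rw [map_smul_eq_mul, Real.norm_of_nonneg (ht w)]
  exact mul_le_of_le_one_right (ht w) (he v hv w (Finset.mem_of_mem_erase hw))

/-! ### Kuhn's triangulation of the integer lattice -/

section Kuhn

variable {ι : Type*} [Fintype ι]

/-- The maximum of `0` and the coordinates of `u`. -/
noncomputable def posSup (u : ι → ℝ) : ℝ := ‖fun i => max (u i) 0‖

theorem posSup_nonneg (u : ι → ℝ) : 0 ≤ posSup u := norm_nonneg _

theorem posSup_le_iff {u : ι → ℝ} {r : ℝ} : posSup u ≤ r ↔ 0 ≤ r ∧ ∀ i, u i ≤ r := by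
  refine ⟨fun h => ?_, fun ⟨h0, h⟩ => (pi_norm_le_iff_of_nonneg h0).2 fun i => ?_⟩
  · have h0 := (posSup_nonneg u).trans h
    refine ⟨h0, fun i => ?_⟩
    have := (pi_norm_le_iff_of_nonneg h0).1 h i
    exact (le_max_left _ _).trans ((le_abs_self _).trans this)
  · rw [Real.norm_of_nonneg (le_max_right _ _)]
    exact max_le (h i) h0

theorem posSup_lt_iff {u : ι → ℝ} {r : ℝ} : posSup u < r ↔ 0 < r ∧ ∀ i, u i < r := by
  refine ⟨fun h => ?_, fun ⟨h0, h⟩ => (pi_norm_lt_iff h0).2 fun i => ?_⟩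
  · have h0 := (posSup_nonneg u).trans_lt h
    refine ⟨h0, fun i => ?_⟩
    have := (pi_norm_lt_iff h0).1 h i
    exact (le_max_left _ _).trans_lt ((le_abs_self _).trans_lt this)
  · rw [Real.norm_of_nonneg (le_max_right _ _)]
    exact max_lt (h i) h0

theorem le_posSup (u : ι → ℝ) (i : ι) : u i ≤ posSup u := (posSup_le_iff.1 le_rfl).2 i

theorem posSup_add_le (u v : ι → ℝ) : posSup (u + v) ≤ posSup u + posSup v :=
  posSup_le_iff.2 ⟨add_nonneg (posSup_nonneg u) (posSup_nonneg v),
    fun i => add_le_add (le_posSup u i) (le_posSup v i)⟩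

theorem posSup_smul_le {a : ℝ} (ha : 0 ≤ a) (u : ι → ℝ) : posSup (a • u) ≤ a * posSup u :=
  posSup_le_iff.2 ⟨mul_nonneg ha (posSup_nonneg u),
    fun i => mul_le_mul_of_nonneg_left (le_posSup u i) ha⟩

theorem posSup_le_norm (u : ι → ℝ) : posSup u ≤ ‖u‖ :=
  posSup_le_iff.2 ⟨norm_nonneg u, fun i => (le_abs_self _).trans (norm_le_pi_norm u i)⟩

theorem exists_int_posSup (w : ι → ℤ) : ∃ k : ℤ, posSup (fun i => (w i : ℝ)) = k := by
  by_cases h : ∃ i, 0 < w i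
  · obtain ⟨i₀, hi₀⟩ := h
    obtain ⟨i, -, hi⟩ := Finset.univ.exists_max_image w ⟨i₀, Finset.mem_univ i₀⟩
    refine ⟨w i, le_antisymm (posSup_le_iff.2 ⟨?_, fun j => ?_⟩) (le_posSup (fun i => (w i : ℝ)) i)⟩
    · exact_mod_cast hi₀.le.trans (hi i₀ (Finset.mem_univ _))
    · exact_mod_cast hi j (Finset.mem_univ _)
  · push Not at h
    refine ⟨0, le_antisymm (posSup_le_iff.2 ⟨by simp, fun j => ?_⟩) (by simpa using posSup_nonneg _)⟩
    exact_mod_cast h j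

/-- The length of the smallest interval that contains `0` and the coordinates of a vector. -/
noncomputable def spread (ι : Type*) [Fintype ι] : Seminorm ℝ (ι → ℝ) :=
  Seminorm.ofSMulLE (fun u => posSup u + posSup (-u))
    (by
      have h : posSup (0 : ι → ℝ) = 0 :=
        le_antisymm (posSup_le_iff.2 ⟨le_rfl, fun _ => le_rfl⟩) (posSup_nonneg _)
      simp [h])
    (fun u v => by
      have h1 := posSup_add_le u v
      have h2 := posSup_add_le (-u) (-v)
      rw [neg_add]
      linarith)
    (fun a u => by
      rcases le_total 0 a with ha | ha
      · have h1 := posSup_smul_le ha u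
        have h2 := posSup_smul_le ha (-u)
        rw [Real.norm_of_nonneg ha, ← smul_neg]
        linarith
      · have h1 := posSup_smul_le (neg_nonneg.2 ha) u
        have h2 := posSup_smul_le (neg_nonneg.2 ha) (-u)
        rw [Real.norm_of_nonpos ha, ← neg_smul]
        rw [neg_smul_neg] at h2
        linarith)

theorem spread_apply (u : ι → ℝ) : spread ι u = posSup u + posSup (-u) := rfl

theorem abs_le_spread (u : ι → ℝ) (i : ι) : |u i| ≤ spread ι u := by
  have h1 := le_posSup u i
  have h2 := le_posSup (-u) i
  have h3 := posSup_nonneg u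
  have h4 := posSup_nonneg (-u)
  rw [spread_apply]
  simp only [Pi.neg_apply] at h2
  exact abs_le.2 ⟨by linarith, by linarith⟩

theorem spread_le_two_mul_norm (u : ι → ℝ) : spread ι u ≤ 2 * ‖u‖ := by
  have h1 := posSup_le_norm u
  have h2 := posSup_le_norm (-u)
  rw [norm_neg] at h2
  rw [spread_apply]
  linarith

theorem spread_continuous : Continuous (spread ι) := by
  have h : Continuous fun u : ι → ℝ => posSup u + posSup (-u) := by
    unfold posSup
    fun_prop
  exact h

/-- This symmetric form is half the `ℓ¹` norm of `(a, b - a, -b)`, the link with the octahedron,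
whose faces lie in planes of constant coordinate sum up to signs. -/
theorem spread_fin_two (a b : ℝ) : spread (Fin 2) ![a, b] = (|a| + |b| + |b - a|) / 2 := by
  have h : ∀ x y : ℝ, posSup ![x, y] = max 0 (max x y) := fun x y => by
    refine eq_of_forall_ge_iff fun r => ?_
    simp [posSup_le_iff, Fin.forall_fin_two]
  rw [spread_apply, show -![a, b] = ![-a, -b] by simp, h, h]
  rcases abs_cases a with ⟨h1, _⟩ | ⟨h1, _⟩ <;> rcases abs_cases b with ⟨h2, _⟩ | ⟨h2, _⟩ <;>
  rcases abs_cases (b - a) with ⟨h3, _⟩ | ⟨h3, _⟩ <;> rw [h1, h2, h3] <;>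
  simp only [max_def] <;> split_ifs <;> linarith

/-- The vector with integer coordinates `w`. -/
def intVec (w : ι → ℤ) : ι → ℝ := fun i => w i

/-- The triangle inequality gives only `< 2`, but the spread of an integer vector is an integer. -/
theorem spread_intVec_sub_le_one {y : ι → ℝ} {v w : ι → ℤ} (hv : spread ι (y - intVec v) < 1)
    (hw : spread ι (y - intVec w) < 1) : spread ι (intVec w - intVec v) ≤ 1 := by
  have h1 : spread ι (intVec w - intVec v) < 2 := by
    have := map_add_le_add (spread ι) (intVec w - y) (y - intVec v)
    rw [sub_add_sub_cancel, map_sub_rev (spread ι) (intVec w) y] at this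
    linarith
  obtain ⟨k, hk⟩ := exists_int_posSup (w - v)
  obtain ⟨l, hl⟩ := exists_int_posSup (-(w - v))
  have h2 : spread ι (intVec w - intVec v) = ((k + l : ℤ) : ℝ) := by
    rw [spread_apply, Int.cast_add, ← hk, ← hl]
    congr 2 <;> ext i <;> simp [intVec]
  rw [h2] at h1 ⊢
  have h3 : k + l < 2 := by exact_mod_cast h1
  exact_mod_cast (by omega : k + l ≤ 1)

/-- The integer points that can be vertices of the Kuhn simplex that contains `y`. -/
noncomputable def kuhnBox (y : ι → ℝ) : Finset (ι → ℤ) := by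
  classical exact Fintype.piFinset fun i => Finset.Icc ⌊y i⌋ (⌊y i⌋ + 1)

theorem mem_kuhnBox {y : ι → ℝ} {w : ι → ℤ} :
    w ∈ kuhnBox y ↔ ∀ i, ⌊y i⌋ ≤ w i ∧ w i ≤ ⌊y i⌋ + 1 := by
  simp [kuhnBox]

theorem card_kuhnBox (y : ι → ℝ) : (kuhnBox y).card = 2 ^ Fintype.card ι := by
  have h : ∀ k : ℤ, (k + 1 + 1 - k).toNat = 2 := fun k => by omega
  simp [kuhnBox, h]

/-- The tent function at the integer point `w` of the Kuhn triangulation of `ι → ℝ`. -/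
noncomputable def kuhnTent (w : ι → ℤ) (y : ι → ℝ) : ℝ := max (1 - spread ι (y - intVec w)) 0

theorem kuhnTent_pos_iff {w : ι → ℤ} {y : ι → ℝ} :
    0 < kuhnTent w y ↔ spread ι (y - intVec w) < 1 := by
  simp [kuhnTent]

theorem abs_sub_lt_one_of_spread {w : ι → ℤ} {y : ι → ℝ} (h : spread ι (y - intVec w) < 1)
    (i : ι) : |y i - w i| < 1 :=
  (abs_le_spread (y - intVec w) i).trans_lt h

theorem mem_kuhnBox_of_spread {w : ι → ℤ} {y : ι → ℝ} (h : spread ι (y - intVec w) < 1) :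
    w ∈ kuhnBox y := by
  refine mem_kuhnBox.2 fun i => ?_
  obtain ⟨h1, h2⟩ := abs_lt.1 (abs_sub_lt_one_of_spread h i)
  have h3 := Int.floor_le (y i)
  have h4 := Int.lt_floor_add_one (y i)
  constructor
  · have : ((⌊y i⌋ : ℤ) : ℝ) < ((w i + 1 : ℤ) : ℝ) := by push_cast; linarith
    have := Int.cast_lt.1 this
    omega
  · have : ((w i : ℤ) : ℝ) < ((⌊y i⌋ + 2 : ℤ) : ℝ) := by push_cast; linarith
    have := Int.cast_lt.1 this
    omega

theorem kuhnTent_eq_zero {w : ι → ℤ} {y : ι → ℝ} (h : w ∉ kuhnBox y) : kuhnTent w y = 0 := by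
  by_contra hne
  exact h (mem_kuhnBox_of_spread (kuhnTent_pos_iff.1 ((le_max_right _ _).lt_of_ne (Ne.symm hne))))

/-- The shifts `θ` for which rounding `y + θ` down gives `w`. -/
noncomputable def roundingSet (y : ι → ℝ) (w : ι → ℤ) : Set ℝ :=
  Ico (posSup (intVec w - y)) (1 - posSup (y - intVec w))

theorem mem_roundingSet {y : ι → ℝ} {w : ι → ℤ} {θ : ℝ} :
    θ ∈ roundingSet y w ↔ θ ∈ Ico (0 : ℝ) 1 ∧ ∀ i, ⌊y i + θ⌋ = w i := by
  rw [roundingSet, mem_Ico, posSup_le_iff, lt_sub_comm, posSup_lt_iff]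
  simp only [Int.floor_eq_iff, mem_Ico, Pi.sub_apply, intVec]
  constructor
  · rintro ⟨⟨h1, h2⟩, h3, h4⟩
    exact ⟨⟨h1, by linarith⟩, fun i => ⟨by linarith [h2 i], by linarith [h4 i]⟩⟩
  · rintro ⟨⟨h1, h2⟩, h3⟩
    exact ⟨⟨h1, fun i => by linarith [(h3 i).1]⟩, by linarith, fun i => by linarith [(h3 i).2]⟩

/-- The tent value is thus the probability that a uniform shift `θ` rounds `y + θ` down to `w`; sums
over tents become measures of disjoint events. -/
theorem volume_roundingSet (y : ι → ℝ) (w : ι → ℤ) :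
    MeasureTheory.volume.real (roundingSet y w) = kuhnTent w y := by
  rw [roundingSet, Real.volume_real_Ico, kuhnTent, spread_apply, neg_sub, sub_sub]

theorem sum_kuhnTent_filter (y : ι → ℝ) (P : (ι → ℤ) → Prop) [DecidablePred P] (a : ℝ)
    (h : ∀ θ ∈ Ico (0 : ℝ) 1, P (fun i => ⌊y i + θ⌋) ↔ a ≤ θ) (ha : a ∈ Icc (0 : ℝ) 1) :
    ∑ w ∈ (kuhnBox y).filter P, kuhnTent w y = 1 - a := by
  simp only [← volume_roundingSet]
  rw [← MeasureTheory.measureReal_biUnion_finset (μ := MeasureTheory.volume)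
    (f := roundingSet y) (h := fun w _ => measure_Ico_lt_top.ne)]
  · have : ⋃ w ∈ (kuhnBox y).filter P, roundingSet y w = Ico a 1 := by
      ext θ
      simp only [mem_iUnion, mem_roundingSet, Finset.mem_filter, exists_prop]
      constructor
      · rintro ⟨w, ⟨-, hP⟩, hθ, hw⟩
        exact ⟨(h θ hθ).1 ((funext hw : (fun i => ⌊y i + θ⌋) = w) ▸ hP), hθ.2⟩
      · intro hθ
        have hθ' : θ ∈ Ico (0 : ℝ) 1 := ⟨ha.1.trans hθ.1, hθ.2⟩
        refine ⟨fun i => ⌊y i + θ⌋, ⟨mem_kuhnBox.2 fun i => ⟨?_, ?_⟩, (h θ hθ').2 hθ.1⟩, hθ',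
          fun i => rfl⟩
        · exact Int.floor_le_floor (by linarith [hθ'.1])
        · rw [← Int.floor_add_one]
          exact Int.floor_le_floor (by linarith [hθ'.2])
    rw [this, Real.volume_real_Ico, max_eq_left (by linarith [ha.2])]
  · intro v _ w _ hvw
    refine Set.disjoint_left.2 fun θ hv hw => hvw ?_
    rw [mem_roundingSet] at hv hw
    ext i
    rw [← hv.2 i, hw.2 i]
  · exact fun w _ => measurableSet_Ico

theorem sum_kuhnTent (y : ι → ℝ) : ∑ w ∈ kuhnBox y, kuhnTent w y = 1 := by
  have := sum_kuhnTent_filter y (fun _ => True) 0 (fun θ hθ => by simp [hθ.1]) (by simp)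
  simpa using this

theorem sum_kuhnTent_mul (y : ι → ℝ) (i : ι) : ∑ w ∈ kuhnBox y, kuhnTent w y * w i = y i := by
  classical
  -- Coordinate `i` rounds to the upper value exactly when `θ ≥ 1 - Int.fract (y i)`, which has
  -- probability `Int.fract (y i)`.
  have h1 : ∑ w ∈ (kuhnBox y).filter (fun w => w i = ⌊y i⌋ + 1), kuhnTent w y
      = 1 - (1 - Int.fract (y i)) := by
    refine sum_kuhnTent_filter y _ _ (fun θ hθ => ?_)
      ⟨by linarith [Int.fract_lt_one (y i)], by linarith [Int.fract_nonneg (y i)]⟩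
    simp only [Int.floor_eq_iff]
    push_cast
    rw [Int.fract]
    constructor
    · rintro ⟨h, -⟩; linarith
    · intro h
      exact ⟨by linarith, by linarith [hθ.2, Int.lt_floor_add_one (y i)]⟩
  have h2 : ∑ w ∈ kuhnBox y, kuhnTent w y * w i = ∑ w ∈ kuhnBox y,
      (kuhnTent w y * ⌊y i⌋ + if w i = ⌊y i⌋ + 1 then kuhnTent w y else 0) := by
    refine Finset.sum_congr rfl fun w hw => ?_
    obtain ⟨h3, h4⟩ := mem_kuhnBox.1 hw i
    split_ifs with h
    · rw [h]; push_cast; ring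
    · rw [show w i = ⌊y i⌋ by omega]; ring
  rw [h2, Finset.sum_add_distrib, ← Finset.sum_mul, sum_kuhnTent, ← Finset.sum_filter, h1,
    Int.fract]
  ring

theorem kuhnTent_nonneg (w : ι → ℤ) (y : ι → ℝ) : 0 ≤ kuhnTent w y := le_max_right _ _

theorem kuhnTent_self (w : ι → ℤ) : kuhnTent w (intVec w) = 1 := by
  simp [kuhnTent]

theorem kuhnTent_continuous (w : ι → ℤ) : Continuous (kuhnTent w) :=
  (continuous_const.sub (spread_continuous.comp (continuous_id.sub continuous_const))).max
    continuous_const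

/-- The point is recovered as the mean of the lattice points weighted by their tents. -/
theorem kuhnTent_injective {y z : ι → ℝ} (h : ∀ w, kuhnTent w y = kuhnTent w z) : y = z := by
  classical
  ext i
  rw [← sum_kuhnTent_mul y i, ← sum_kuhnTent_mul z i,
    Finset.sum_subset (s₂ := kuhnBox y ∪ kuhnBox z) Finset.subset_union_left
      fun w _ hw => by rw [kuhnTent_eq_zero hw, zero_mul],
    Finset.sum_subset (s₁ := kuhnBox z) (s₂ := kuhnBox y ∪ kuhnBox z) Finset.subset_union_right
      fun w _ hw => by rw [kuhnTent_eq_zero hw, zero_mul]]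
  exact Finset.sum_congr rfl fun w _ => by rw [h w]

theorem spread_barycenter_sub_le {W : Type*} {e : W → ι → ℤ} {s : Finset W} {y₀ : ι → ℝ}
    (hs : ∀ v ∈ s, spread ι (y₀ - intVec (e v)) < 1) {t : W → ℝ} (ht : ∀ v, 0 ≤ t v)
    (ht1 : ∑ v ∈ s, t v = 1) {v : W} (hv : v ∈ s) :
    spread ι (∑ w ∈ s, t w • intVec (e w) - intVec (e v)) ≤ 1 - t v :=
  (spread ι).barycenter_sub_le (e := fun w => intVec (e w)) ht ht1
    (fun v hv w hw => spread_intVec_sub_le_one (hs v hv) (hs w hw)) hv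

end Kuhn

theorem locallyFinite_kuhnTent_pos {ι : Type*} [Fintype ι] :
    LocallyFinite fun (w : ι → ℤ) => {y : ι → ℝ | 0 < kuhnTent w y} := by
  classical
  intro y
  refine ⟨Metric.ball y 1, Metric.ball_mem_nhds y one_pos, ?_⟩
  refine (Fintype.piFinset fun i => Finset.Icc (⌊y i⌋ - 2) (⌊y i⌋ + 3)).finite_toSet.subset ?_
  rintro w ⟨z, hz, hzy⟩
  simp only [Finset.mem_coe, Fintype.mem_piFinset, Finset.mem_Icc]
  intro i
  obtain ⟨h1, h2⟩ := abs_lt.1 (abs_sub_lt_one_of_spread (kuhnTent_pos_iff.1 hz) i)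
  obtain ⟨h3, h4⟩ := abs_lt.1 (Real.dist_eq _ _ ▸ (dist_le_pi_dist z y i).trans_lt hzy)
  have h5 := Int.floor_le (y i)
  have h6 := Int.lt_floor_add_one (y i)
  constructor
  · exact_mod_cast (by push_cast; linarith : ((⌊y i⌋ - 2 : ℤ) : ℝ) ≤ (w i : ℝ))
  · exact_mod_cast (by push_cast; linarith : (w i : ℝ) ≤ ((⌊y i⌋ + 3 : ℤ) : ℝ))

/-! ### Affine subspaces -/

namespace EuclideanSpace

variable {m d : ℕ} (φ : EuclideanSpace ℝ (Fin m) →ᵃⁱ[ℝ] EuclideanSpace ℝ (Fin d)) (ε : ℝ)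

/-- The coordinates, in units of `ε`, of the orthogonal projection to the image of the linear part
of `φ`. -/
noncomputable def scaledCoords : EuclideanSpace ℝ (Fin d) →ₗ[ℝ] (Fin m → ℝ) :=
  LinearMap.pi fun i =>
    ε⁻¹ • (innerSL ℝ (φ.linearIsometry (EuclideanSpace.single i 1))).toLinearMap

/-- The affine coordinates, in units of `ε`, on the image of `φ`. -/
noncomputable def gridCoords (x : EuclideanSpace ℝ (Fin d)) : Fin m → ℝ :=
  scaledCoords φ ε x - scaledCoords φ ε (φ 0)

/-- The point with given affine coordinates. -/
noncomputable def gridPoint (y : Fin m → ℝ) : EuclideanSpace ℝ (Fin d) :=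
  φ (ε • WithLp.toLp 2 y)

theorem scaledCoords_apply (x : EuclideanSpace ℝ (Fin d)) (i : Fin m) :
    scaledCoords φ ε x i = ε⁻¹ * inner ℝ (φ.linearIsometry (EuclideanSpace.single i 1)) x := rfl

theorem gridCoords_map (z : EuclideanSpace ℝ (Fin m)) (i : Fin m) :
    gridCoords φ ε (φ z) i = ε⁻¹ * z i := by
  have h : φ z - φ 0 = φ.linearIsometry z := by
    have := φ.map_vsub z 0
    simpa using this.symm
  rw [gridCoords, ← map_sub, h, scaledCoords_apply, LinearIsometry.inner_map_map]
  simp [EuclideanSpace.inner_single_left]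

theorem norm_scaledCoords_le (hε : 0 < ε) (x : EuclideanSpace ℝ (Fin d)) :
    ‖scaledCoords φ ε x‖ ≤ ε⁻¹ * ‖x‖ := by
  refine (pi_norm_le_iff_of_nonneg (by positivity)).2 fun i => ?_
  rw [scaledCoords_apply, norm_mul, Real.norm_of_nonneg (by positivity)]
  refine mul_le_mul_of_nonneg_left ((norm_inner_le_norm _ _).trans ?_) (by positivity)
  simp

theorem gridCoords_gridPoint (hε : ε ≠ 0) (y : Fin m → ℝ) :
    gridCoords φ ε (gridPoint φ ε y) = y := by
  ext i
  rw [gridPoint, gridCoords_map]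
  simp [hε]

theorem gridPoint_gridCoords (hε : ε ≠ 0) {x : EuclideanSpace ℝ (Fin d)} (hx : x ∈ range φ) :
    gridPoint φ ε (gridCoords φ ε x) = x := by
  obtain ⟨z, rfl⟩ := hx
  rw [gridPoint]
  congr 1
  ext i
  simp [gridCoords_map, hε]

theorem gridPoint_mem (y : Fin m → ℝ) : gridPoint φ ε y ∈ range φ := mem_range_self _

theorem continuous_gridCoords : Continuous (gridCoords φ ε) :=
  ((scaledCoords φ ε).continuous_of_finiteDimensional).sub continuous_const

theorem dist_gridPoint_le (hε : 0 < ε) {y z : Fin m → ℝ} (h : ∀ i, |y i - z i| ≤ 1) :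
    dist (gridPoint φ ε y) (gridPoint φ ε z) ≤ ε * m := by
  rw [gridPoint, gridPoint, φ.dist_map, dist_smul₀, Real.norm_of_nonneg hε.le]
  refine mul_le_mul_of_nonneg_left ?_ hε.le
  rw [EuclideanSpace.dist_eq, Real.sqrt_le_left (by positivity)]
  have h1 : ∀ i : Fin m, dist (y i) (z i) ^ 2 ≤ 1 := fun i => by
    rw [Real.dist_eq]
    nlinarith [h i, abs_nonneg (y i - z i)]
  refine (Finset.sum_le_sum fun i _ => h1 i).trans ?_
  simp only [Finset.sum_const, Finset.card_univ, Fintype.card_fin, nsmul_eq_mul, mul_one]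
  exact_mod_cast Nat.le_self_pow two_ne_zero m

theorem gridTentFamily (hε : 0 < ε) :
    TentFamily (range φ) (fun (w : Fin m → ℤ) x => kuhnTent w (gridCoords φ ε x)) (2 ^ m) where
  isClosed := φ.isometry.isClosedEmbedding.isClosed_range
  continuousOn v := ((kuhnTent_continuous v).comp (continuous_gridCoords φ ε)).continuousOn
  nonneg v x _ := kuhnTent_nonneg v _
  locallyFinite := (locallyFinite_kuhnTent_pos.preimage_continuous
    (continuous_gridCoords φ ε)).subset fun v x hx => hx.2
  partition x _ := ⟨kuhnBox (gridCoords φ ε x), by simp [card_kuhnBox],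
    fun v hv => kuhnTent_eq_zero hv, sum_kuhnTent _⟩
  separates x hx y hy h := by
    rw [← gridPoint_gridCoords φ ε hε.ne' hx, ← gridPoint_gridCoords φ ε hε.ne' hy,
      kuhnTent_injective h]
  realize s x₀ _ hs t ht ht1 := by
    refine ⟨_, gridPoint_mem φ ε (∑ w ∈ s, t w • intVec w), fun v hv => ?_⟩
    rw [gridCoords_gridPoint φ ε hε.ne']
    have := spread_barycenter_sub_le (e := fun w => w)
      (fun v hv => kuhnTent_pos_iff.1 (hs v hv)) ht ht1 hv
    exact le_max_of_le_left (by linarith)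
  peak v := ⟨_, gridPoint_mem φ ε (intVec v), by
    rw [gridCoords_gridPoint φ ε hε.ne', kuhnTent_self]⟩
  isBounded v := by
    refine (Metric.isBounded_closedBall (x := gridPoint φ ε (intVec v)) (r := ε * m)).subset ?_
    rintro x ⟨hx, hv⟩
    rw [Metric.mem_closedBall, ← gridPoint_gridCoords φ ε hε.ne' hx]
    exact dist_gridPoint_le φ ε hε fun i =>
      (abs_sub_lt_one_of_spread (kuhnTent_pos_iff.1 hv) i).le

theorem isNicelyTriangulable_range : IsNicelyTriangulable (range φ) := by
  -- Mesh `ε = ρ / (m + 1)` makes the tent radius `ε * m` smaller than `ρ`, also for `m = 0`. With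
  -- `L = 2 / ε` and this `η₀`, `L * δ` is half of `c = 1 / 2 ^ m`. The bound `ρ₀ = 1` plays no
  -- role.
  refine ⟨1, one_pos, 1 / (4 * (m + 1) * 2 ^ m), by positivity, fun ρ hρ _ => ?_⟩
  have hε : 0 < ρ / (m + 1) := by positivity
  set ε := ρ / (m + 1) with hεdef
  have H := gridTentFamily φ ε hε
  refine ⟨Fin m → ℤ, H.complex, H.homeomorph.symm, TentFamily.cell (range φ) _,
    H.isNiceTriangulation (c := 1 / 2 ^ m) (L := 2 * ε⁻¹) (κ := fun _ => Unit) hρ (by positivity)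
    ?_ (fun v => gridPoint φ ε (intVec v)) (fun v => gridPoint_mem φ ε _) (fun v => ?_)
    (fun v x hx hv => ?_) (fun v _ x => 1 - spread (Fin m) (gridCoords φ ε x - intVec v))
    (fun v _ => ?_) (fun v _ x y => ?_) (by positivity) (fun v _ x _ h => ?_)
    (fun v x _ h => kuhnTent_pos_iff.2 (by linarith [h ()]))⟩
  · rw [hεdef]
    have h : 2 * (ρ / ((m : ℝ) + 1))⁻¹ * (1 / (4 * (m + 1) * 2 ^ m) * ρ) = 1 / 2 ^ m / 2 := by
      field_simp
      norm_num
    rw [h]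
    exact half_lt_self (by positivity)
  · rw [gridCoords_gridPoint φ ε hε.ne', kuhnTent_self]
  · rw [← gridPoint_gridCoords φ ε hε.ne' hx]
    refine (dist_gridPoint_le φ ε hε fun i =>
      (abs_sub_lt_one_of_spread (kuhnTent_pos_iff.1 hv) i).le).trans_lt ?_
    rw [hεdef, div_mul_eq_mul_div, div_lt_iff₀ (by positivity)]
    nlinarith
  · refine (concaveOn_const 1 convex_univ).sub ?_
    have := (spread (Fin m)).convexOn.comp_affineMap
      ((scaledCoords φ ε).toAffineMap - AffineMap.const ℝ _ (scaledCoords φ ε (φ 0) + intVec v))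
    rw [preimage_univ] at this
    refine this.congr fun x _ => ?_
    simp [gridCoords, sub_sub]
  · have h1 := map_add_le_add (spread (Fin m)) (gridCoords φ ε x - intVec v)
      (gridCoords φ ε y - gridCoords φ ε x)
    rw [add_comm, sub_add_sub_cancel] at h1
    have h2 := spread_le_two_mul_norm (gridCoords φ ε y - gridCoords φ ε x)
    have h3 := norm_scaledCoords_le φ ε hε (y - x)
    rw [map_sub, ← dist_eq_norm y x, dist_comm] at h3
    rw [gridCoords, gridCoords, sub_sub_sub_cancel_right] at h2
    rw [gridCoords, gridCoords] at h1 ⊢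
    rw [sub_sub_sub_cancel_right] at h1
    linarith
  · have h1 : 0 < 1 / ((2 ^ m : ℕ) : ℝ) := by positivity
    have h2 := (lt_max_iff.1 (h1.trans_le h)).resolve_right (lt_irrefl 0)
    rw [kuhnTent, max_eq_left h2.le] at h
    exact_mod_cast h

end EuclideanSpace

/-- Half the `ℓ¹` norm. -/
noncomputable def halfL1 (ι : Type*) [Fintype ι] : Seminorm ℝ (ι → ℝ) :=
  Seminorm.ofSMulLE (fun u => (∑ i, |u i|) / 2) (by simp)
    (fun u v => by
      rw [← add_div, ← Finset.sum_add_distrib]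
      gcongr with i
      exact abs_add_le _ _)
    (fun a u => by
      simp only [Pi.smul_apply, smul_eq_mul, abs_mul, ← Finset.mul_sum, Real.norm_eq_abs]
      exact (mul_div_assoc _ _ _).le)

theorem halfL1_apply {ι : Type*} [Fintype ι] (u : ι → ℝ) : halfL1 ι u = (∑ i, |u i|) / 2 := rfl

/-- If the signs at `i` did not agree, that coordinate would contribute `|X i| + |v i|`. As the `ℓ¹`
norms are equal, the remaining coordinates contribute at least `|X i| - |v i|` less than is needed
to cancel, and the total would be at least `2 * |v i| ≥ 2`. -/
theorem mul_pos_of_halfL1_lt_one {ι : Type*} [Fintype ι] {X : ι → ℝ} {v : ι → ℤ}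
    (hXv : ∑ i, |X i| = ∑ i, |(v i : ℝ)|) (h : halfL1 ι (X - intVec v) < 1) {i : ι}
    (hi : v i ≠ 0) : 0 < X i * v i := by
  classical
  by_contra! hle
  have h1 : |(v i : ℝ)| ≥ 1 := by exact_mod_cast Int.one_le_abs hi
  have h2 : |X i - v i| = |X i| + |(v i : ℝ)| := by
    rcases abs_cases (X i) with ⟨e1, _⟩ | ⟨e1, _⟩ <;> rcases abs_cases (v i : ℝ) with ⟨e2, _⟩ | ⟨e2, _⟩
    · rw [e2] at h1
      rw [show X i = 0 by nlinarith, zero_sub, abs_neg, abs_zero, zero_add]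
    · rw [e1, e2, abs_of_nonneg (by linarith)]; ring
    · rw [e1, e2, abs_of_nonpos (by linarith)]; ring
    · rw [e2] at h1
      nlinarith
  have h3 : ∑ j, (|X j| - |(v j : ℝ)| + if j = i then 2 * |(v i : ℝ)| else 0) ≤ ∑ j, |X j - v j| := by
    refine Finset.sum_le_sum fun j _ => ?_
    split_ifs with hj
    · subst hj; rw [h2]; linarith
    · rw [add_zero]; exact abs_sub_abs_le_abs_sub _ _
  rw [Finset.sum_add_distrib, Finset.sum_sub_distrib, hXv, sub_self, zero_add,
    Finset.sum_ite_eq' Finset.univ i, if_pos (Finset.mem_univ i)] at h3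
  rw [halfL1_apply] at h
  simp only [Pi.sub_apply, intVec] at h
  linarith

/-- The lattice points on the octahedron of size `n`. -/
abbrev OctPoint (n : ℕ) : Type := {v : Fin 3 → ℤ // ∑ i, |v i| = n}

/-! ### The triangulated octahedron -/

namespace OctPoint

variable {n : ℕ}

instance : Finite (OctPoint n) := by
  refine ((Set.finite_Icc (fun _ : Fin 3 => -(n : ℤ)) fun _ => (n : ℤ)).subset fun v hv => ?_).to_subtype
  have h : ∀ i, |v i| ≤ n := fun i => by
    rw [← show ∑ i, |v i| = n from hv]
    exact Finset.single_le_sum (fun i _ => abs_nonneg (v i)) (Finset.mem_univ i)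
  exact ⟨fun i => (abs_le.1 (h i)).1, fun i => (abs_le.1 (h i)).2⟩

noncomputable instance : Fintype (OctPoint n) := Fintype.ofFinite _

/-- The tent function of a lattice point on the octahedron of size `n`. -/
noncomputable def tent (v : OctPoint n) (X : Fin 3 → ℝ) : ℝ :=
  max (1 - halfL1 (Fin 3) (X - intVec v.1)) 0

theorem tent_pos_iff {v : OctPoint n} {X : Fin 3 → ℝ} :
    0 < v.tent X ↔ halfL1 (Fin 3) (X - intVec v.1) < 1 := by
  simp [tent]

theorem tent_nonneg (v : OctPoint n) (X : Fin 3 → ℝ) : 0 ≤ v.tent X := le_max_right _ _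

theorem sum_abs_cast (v : OctPoint n) : ∑ i, |(v.1 i : ℝ)| = n := by exact_mod_cast v.2

/-- Planar lattice coordinates of an octahedral point, in its octant. -/
def planar (v : OctPoint n) : Fin 2 → ℤ := ![|v.1 0|, |v.1 0| + |v.1 1|]

/-- The sign `±1` of a real number, `1` at `0`. -/
noncomputable def sg (x : ℝ) : ℤ := if 0 ≤ x then 1 else -1

theorem sg_mul_abs (x : ℝ) : (sg x : ℝ) * |x| = x := by
  rw [sg]
  split_ifs with h
  · rw [abs_of_nonneg h]; simp
  · rw [abs_of_neg (not_le.1 h)]; simp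

theorem abs_sg (x : ℝ) : |sg x| = 1 := by
  rw [sg]
  split_ifs <;> simp

theorem sg_mul_abs_of_tent_pos {X : Fin 3 → ℝ} (hX : ∑ i, |X i| = n) {v : OctPoint n}
    (h : 0 < v.tent X) (i : Fin 3) : sg (X i) * |v.1 i| = v.1 i := by
  by_cases hi : v.1 i = 0
  · simp [hi]
  have h1 := mul_pos_of_halfL1_lt_one (hX.trans v.sum_abs_cast.symm) (tent_pos_iff.1 h) hi
  rw [sg]
  split_ifs with h2
  · have : (0 : ℝ) < v.1 i := pos_of_mul_pos_right h1 h2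
    rw [one_mul, abs_of_pos (by exact_mod_cast this)]
  · have : (v.1 i : ℝ) < 0 := by nlinarith
    rw [abs_of_neg (by exact_mod_cast this)]
    ring

theorem abs_sub_eq_of_sg {X : Fin 3 → ℝ} {v : Fin 3 → ℤ} {i : Fin 3}
    (h : sg (X i) * |v i| = v i) : |X i - v i| = |(|X i| - |(v i : ℝ)|)| := by
  have h' : (v i : ℝ) = sg (X i) * |(v i : ℝ)| := by exact_mod_cast h.symm
  have h1 : |(sg (X i) : ℝ)| = 1 := by exact_mod_cast abs_sg (X i)
  have h2 : X i - v i = sg (X i) * (|X i| - |(v i : ℝ)|) := by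
    rw [mul_sub, sg_mul_abs, ← h']
  rw [h2, abs_mul, h1, one_mul]

/-- Within an octant the differences of absolute values sum to zero, so the third is determined by
the first two and `spread_fin_two` applies. -/
theorem halfL1_eq_spread {X : Fin 3 → ℝ} (hX : ∑ i, |X i| = n) {v : OctPoint n}
    (h : ∀ i, sg (X i) * |v.1 i| = v.1 i) :
    halfL1 (Fin 3) (X - intVec v.1) =
      spread (Fin 2) (![|X 0|, |X 0| + |X 1|] - intVec v.planar) := by
  have h1 : ![|X 0|, |X 0| + |X 1|] - intVec v.planar = ![|X 0| - |(v.1 0 : ℝ)|,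
      |X 0| - |(v.1 0 : ℝ)| + (|X 1| - |(v.1 1 : ℝ)|)] := by
    ext i
    fin_cases i <;> simp [intVec, planar]
    ring
  have hv := v.sum_abs_cast
  rw [Fin.sum_univ_three] at hX hv
  rw [h1, spread_fin_two, halfL1_apply, Fin.sum_univ_three, add_sub_cancel_left]
  simp only [Pi.sub_apply, intVec, abs_sub_eq_of_sg (h _)]
  rw [← abs_neg (|X 2| - _), show -(|X 2| - |(v.1 2 : ℝ)|) =
    |X 0| - |(v.1 0 : ℝ)| + (|X 1| - |(v.1 1 : ℝ)|) by linarith]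
  ring

theorem tent_eq_kuhnTent {X : Fin 3 → ℝ} (hX : ∑ i, |X i| = n) {v : OctPoint n}
    (h : ∀ i, sg (X i) * |v.1 i| = v.1 i) :
    v.tent X = kuhnTent v.planar ![|X 0|, |X 0| + |X 1|] := by
  rw [tent, kuhnTent, halfL1_eq_spread hX h]

/-- The triangle `0 ≤ a ≤ b ≤ n` is a union of Kuhn simplices: an integer point with positive tent
at a point of it violates each integral inequality by less than one, so it satisfies them all. -/
theorem exists_planar_eq {X : Fin 3 → ℝ} (hX : ∑ i, |X i| = n) {w : Fin 2 → ℤ}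
    (hw : 0 < kuhnTent w ![|X 0|, |X 0| + |X 1|]) :
    ∃ v : OctPoint n, v.planar = w ∧ ∀ i, sg (X i) * |v.1 i| = v.1 i := by
  rw [kuhnTent_pos_iff, show ![|X 0|, |X 0| + |X 1|] - intVec w = ![|X 0| - w 0,
    |X 0| + |X 1| - w 1] by ext i; fin_cases i <;> simp [intVec], spread_fin_two] at hw
  rw [Fin.sum_univ_three] at hX
  have a0 := abs_nonneg (X 0)
  have a1 := abs_nonneg (X 1)
  have a2 := abs_nonneg (X 2)
  have b0 := abs_le.1 (le_refl |(|X 0| - w 0)|)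
  have b1 := abs_le.1 (le_refl |(|X 0| + |X 1| - w 1)|)
  have b2 := abs_le.1 (le_refl |(|X 0| + |X 1| - w 1 - (|X 0| - w 0))|)
  have c0 : 0 ≤ w 0 := by
    have : ((-1 : ℤ) : ℝ) < w 0 := by push_cast; linarith
    have := Int.cast_lt.1 this
    omega
  have c1 : w 0 ≤ w 1 := by
    have : ((w 0 - 1 : ℤ) : ℝ) < w 1 := by push_cast; linarith
    have := Int.cast_lt.1 this
    omega
  have c2 : w 1 ≤ n := by
    have : (w 1 : ℝ) < ((n + 1 : ℤ) : ℝ) := by push_cast; linarith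
    have := Int.cast_lt.1 this
    omega
  have d : ∀ (x : ℝ) {k : ℤ}, 0 ≤ k → |sg x * k| = k := fun x k hk => by
    rw [abs_mul, abs_sg, one_mul, abs_of_nonneg hk]
  have d0 := d (X 0) c0
  have d1 := d (X 1) (sub_nonneg.2 c1)
  have d2 := d (X 2) (sub_nonneg.2 c2)
  refine ⟨⟨![sg (X 0) * w 0, sg (X 1) * (w 1 - w 0), sg (X 2) * (n - w 1)], ?_⟩, ?_, ?_⟩
  · rw [Fin.sum_univ_three]
    change |sg (X 0) * w 0| + |sg (X 1) * (w 1 - w 0)| + |sg (X 2) * (n - w 1)| = n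
    omega
  · ext i
    fin_cases i
    · exact d0
    · change |sg (X 0) * w 0| + |sg (X 1) * (w 1 - w 0)| = w 1
      omega
  · intro i
    fin_cases i
    · exact congrArg _ d0
    · exact congrArg _ d1
    · exact congrArg _ d2

theorem eq_of_planar_eq {X : Fin 3 → ℝ} {u v : OctPoint n}
    (hu : ∀ i, sg (X i) * |u.1 i| = u.1 i) (hv : ∀ i, sg (X i) * |v.1 i| = v.1 i)
    (h : u.planar = v.planar) : u = v := by
  have h0 : |u.1 0| = |v.1 0| := congrFun h 0
  have h1 : |u.1 0| + |u.1 1| = |v.1 0| + |v.1 1| := congrFun h 1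
  have hu2 := u.2
  have hv2 := v.2
  rw [Fin.sum_univ_three] at hu2 hv2
  refine Subtype.ext (funext fun i => ?_)
  rw [← hu i, ← hv i]
  congr 1
  fin_cases i
  · exact h0
  · change |u.1 1| = |v.1 1|
    omega
  · change |u.1 2| = |v.1 2|
    omega

/-- All lattice points active at `X` lie in the closed octant of `X`, where `planar` matches them
with the active planar lattice points. Sums over the octahedron thereby reduce to the planar Kuhn
sums. -/
theorem sum_tent_mul {X : Fin 3 → ℝ} (hX : ∑ i, |X i| = n) (f : (Fin 2 → ℤ) → ℝ) :
    ∑ v : OctPoint n, v.tent X * f v.planar =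
      ∑ w ∈ kuhnBox ![|X 0|, |X 0| + |X 1|], kuhnTent w ![|X 0|, |X 0| + |X 1|] * f w := by
  have hpos : ∀ {v : OctPoint n}, v.tent X * f v.planar ≠ 0 → 0 < v.tent X := fun {v} h =>
    (v.tent_nonneg X).lt_of_ne (left_ne_zero_of_mul h).symm
  refine Finset.sum_bij_ne_zero (fun v _ _ => v.planar) (fun v _ h => ?_) (fun u _ hu v _ hv h => ?_)
    (fun w _ hw => ?_) (fun v _ h => ?_)
  · have h1 := hpos h
    rw [tent_eq_kuhnTent hX (sg_mul_abs_of_tent_pos hX h1)] at h1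
    exact mem_kuhnBox_of_spread (kuhnTent_pos_iff.1 h1)
  · exact eq_of_planar_eq (sg_mul_abs_of_tent_pos hX (hpos hu))
      (sg_mul_abs_of_tent_pos hX (hpos hv)) h
  · obtain ⟨v, rfl, hv⟩ := exists_planar_eq hX
      ((kuhnTent_nonneg _ _).lt_of_ne (left_ne_zero_of_mul hw).symm)
    exact ⟨v, Finset.mem_univ v, by rwa [tent_eq_kuhnTent hX hv], rfl⟩
  · rw [tent_eq_kuhnTent hX (sg_mul_abs_of_tent_pos hX (hpos h))]

theorem sum_tent {X : Fin 3 → ℝ} (hX : ∑ i, |X i| = n) : ∑ v : OctPoint n, v.tent X = 1 := by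
  simpa [sum_kuhnTent] using sum_tent_mul hX fun _ => 1

theorem sum_tent_mul_coord {X : Fin 3 → ℝ} (hX : ∑ i, |X i| = n) (i : Fin 3) :
    ∑ v : OctPoint n, v.tent X * v.1 i = X i := by
  have h0 := sum_tent_mul hX fun w => w 0
  have h1 := sum_tent_mul hX fun w => w 1
  have h2 := sum_tent hX
  have habs : ∑ v : OctPoint n, v.tent X * |(v.1 i : ℝ)| = |X i| := by
    rw [sum_kuhnTent_mul] at h0 h1
    simp only [planar, Matrix.cons_val_zero, Matrix.cons_val_one, Int.cast_add,
      Int.cast_abs] at h0 h1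
    have hX' := hX
    rw [Fin.sum_univ_three] at hX'
    have e1 : ∑ v : OctPoint n, v.tent X * |(v.1 1 : ℝ)| = |X 1| := by
      simp only [mul_add, Finset.sum_add_distrib] at h1
      linarith
    fin_cases i
    · exact h0
    · exact e1
    · have e2 : ∀ v : OctPoint n, v.tent X * |(v.1 2 : ℝ)| =
          v.tent X * n - v.tent X * |(v.1 0 : ℝ)| - v.tent X * |(v.1 1 : ℝ)| := fun v => by
        have := v.sum_abs_cast
        rw [Fin.sum_univ_three] at this
        rw [← this]; ring
      change ∑ v : OctPoint n, v.tent X * |(v.1 2 : ℝ)| = |X 2|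
      simp only [e2, Finset.sum_sub_distrib, ← Finset.sum_mul, h2, h0, e1]
      linarith
  rw [← sg_mul_abs (X i), ← habs, Finset.mul_sum]
  refine Finset.sum_congr rfl fun v _ => ?_
  rcases (v.tent_nonneg X).eq_or_lt with h | h
  · simp [← h]
  · have : (v.1 i : ℝ) = sg (X i) * |(v.1 i : ℝ)| := by
      exact_mod_cast (sg_mul_abs_of_tent_pos hX h i).symm
    conv_lhs => rw [this]
    ring

/-- The crude bound by the four corners of a planar lattice square suffices. -/
theorem card_tent_pos_le {X : Fin 3 → ℝ} (hX : ∑ i, |X i| = n) :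
    (Finset.univ.filter fun v : OctPoint n => 0 < v.tent X).card ≤ 4 := by
  have h := card_kuhnBox ![|X 0|, |X 0| + |X 1|]
  rw [Fintype.card_fin] at h
  change _ ≤ 2 ^ 2
  rw [← h]
  refine Finset.card_le_card_of_injOn planar (fun v hv => ?_) fun u hu v hv huv => ?_
  · have h1 := (Finset.mem_filter.1 hv).2
    rw [tent_eq_kuhnTent hX (sg_mul_abs_of_tent_pos hX h1)] at h1
    exact mem_kuhnBox_of_spread (kuhnTent_pos_iff.1 h1)
  · exact eq_of_planar_eq (sg_mul_abs_of_tent_pos hX (Finset.mem_filter.1 hu).2)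
      (sg_mul_abs_of_tent_pos hX (Finset.mem_filter.1 hv).2) huv

/-- Lattice points of equal `ℓ¹` norm are at even `ℓ¹` distance, so a distance below 4 is at most 2.
-/
theorem halfL1_sub_le_one {X : Fin 3 → ℝ} {v w : OctPoint n} (hv : 0 < v.tent X)
    (hw : 0 < w.tent X) : halfL1 (Fin 3) (intVec w.1 - intVec v.1) ≤ 1 := by
  rw [tent_pos_iff] at hv hw
  have h1 : halfL1 (Fin 3) (intVec w.1 - intVec v.1) < 2 := by
    have := map_add_le_add (halfL1 (Fin 3)) (intVec w.1 - X) (X - intVec v.1)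
    rw [sub_add_sub_cancel, map_sub_rev (halfL1 (Fin 3)) (intVec w.1) X] at this
    linarith
  rw [halfL1_apply] at h1 ⊢
  simp only [Pi.sub_apply, intVec] at h1 ⊢
  have h2 : ∑ i, |w.1 i - v.1 i| < 4 := by
    have : ∑ i, |(w.1 i : ℝ) - v.1 i| < 4 := by linarith
    exact_mod_cast this
  have h3 : ∑ i, |w.1 i - v.1 i| ≤ 2 := by
    have par : ∀ a : ℤ, ∃ k, |a| = a + 2 * k := fun a => by
      rcases abs_choice a with h | h
      · exact ⟨0, by omega⟩
      · exact ⟨-a, by omega⟩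
    have hv2 := v.2
    have hw2 := w.2
    rw [Fin.sum_univ_three] at *
    obtain ⟨_, h⟩ := par (v.1 0)
    obtain ⟨_, h⟩ := par (v.1 1)
    obtain ⟨_, h⟩ := par (v.1 2)
    obtain ⟨_, h⟩ := par (w.1 0)
    obtain ⟨_, h⟩ := par (w.1 1)
    obtain ⟨_, h⟩ := par (w.1 2)
    obtain ⟨_, h⟩ := par (w.1 0 - v.1 0)
    obtain ⟨_, h⟩ := par (w.1 1 - v.1 1)
    obtain ⟨_, h⟩ := par (w.1 2 - v.1 2)
    omega
  have h4 : ∑ i, |(w.1 i : ℝ) - v.1 i| ≤ 2 := by exact_mod_cast h3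
  linarith

/-- The barycentre of lattice points in one closed octant stays on the same face, since the `ℓ¹`
norm is linear there. -/
theorem exists_le_tent {X₀ : Fin 3 → ℝ} (hX₀ : ∑ i, |X₀ i| = n) {s : Finset (OctPoint n)}
    (hs : ∀ v ∈ s, 0 < v.tent X₀) {t : OctPoint n → ℝ} (ht : ∀ v, 0 ≤ t v)
    (ht1 : ∑ v ∈ s, t v = 1) :
    ∃ X : Fin 3 → ℝ, ∑ i, |X i| = n ∧ ∀ v ∈ s, t v ≤ v.tent X := by
  refine ⟨∑ w ∈ s, t w • intVec w.1, ?_, fun v hv => ?_⟩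
  · have h : ∀ i, |(∑ w ∈ s, t w • intVec w.1) i| = ∑ w ∈ s, t w * |(w.1 i : ℝ)| := fun i => by
      have : (∑ w ∈ s, t w • intVec w.1) i = sg (X₀ i) * ∑ w ∈ s, t w * |(w.1 i : ℝ)| := by
        rw [Finset.sum_apply, Finset.mul_sum]
        refine Finset.sum_congr rfl fun w hw => ?_
        have : (w.1 i : ℝ) = sg (X₀ i) * |(w.1 i : ℝ)| := by
          exact_mod_cast (sg_mul_abs_of_tent_pos hX₀ (hs w hw) i).symm
        rw [Pi.smul_apply, smul_eq_mul, intVec]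
        conv_lhs => rw [this]
        ring
      have h1 : |(sg (X₀ i) : ℝ)| = 1 := by exact_mod_cast abs_sg (X₀ i)
      rw [this, abs_mul, h1, one_mul,
        abs_of_nonneg (Finset.sum_nonneg fun w _ => mul_nonneg (ht w) (abs_nonneg _))]
    simp only [h]
    rw [Finset.sum_comm]
    simp only [← Finset.mul_sum, sum_abs_cast]
    rw [← Finset.sum_mul, ht1, one_mul]
  · have := (halfL1 (Fin 3)).barycenter_sub_le (e := fun w : OctPoint n => intVec w.1) ht ht1
      (fun v hv w hw => halfL1_sub_le_one (hs v hv) (hs w hw)) hv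
    exact le_max_of_le_left (by linarith)

end OctPoint

theorem dist_inv_norm_smul_le {F : Type*} [NormedAddCommGroup F] [NormedSpace ℝ F] {a b : F}
    (ha : a ≠ 0) (hb : b ≠ 0) : dist (‖a‖⁻¹ • a) (‖b‖⁻¹ • b) ≤ 2 * dist a b / ‖b‖ := by
  have ha' := norm_pos_iff.2 ha
  have hb' := norm_pos_iff.2 hb
  have h : ‖a‖⁻¹ • a - ‖b‖⁻¹ • b = ‖b‖⁻¹ • (a - b) + ((‖b‖ - ‖a‖) / (‖a‖ * ‖b‖)) • a := by
    rw [smul_sub, sub_div, div_mul_cancel_right₀ hb'.ne', div_mul_cancel_left₀ ha'.ne', sub_smul]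
    abel
  rw [dist_eq_norm, h, dist_eq_norm]
  refine (norm_add_le _ _).trans ?_
  rw [norm_smul, norm_smul, norm_inv, norm_norm, norm_div, norm_mul, norm_norm, norm_norm]
  have h2 : ‖‖b‖ - ‖a‖‖ ≤ ‖a - b‖ := by
    rw [norm_sub_rev a b]
    exact abs_norm_sub_norm_le b a
  have h3 : ‖‖b‖ - ‖a‖‖ / (‖a‖ * ‖b‖) * ‖a‖ = ‖b‖⁻¹ * ‖‖b‖ - ‖a‖‖ := by field_simp
  rw [h3, ← mul_add, div_eq_inv_mul]
  refine mul_le_mul_of_nonneg_left ?_ (by positivity)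
  linarith

theorem EuclideanSpace.abs_apply_le_norm {ι : Type*} [Fintype ι] (x : EuclideanSpace ℝ ι) (i : ι) :
    |x i| ≤ ‖x‖ := PiLp.norm_apply_le x i

theorem EuclideanSpace.norm_le_sum_abs {ι : Type*} [Fintype ι] (x : EuclideanSpace ℝ ι) :
    ‖x‖ ≤ ∑ i, |x i| := by
  rw [EuclideanSpace.norm_eq, Real.sqrt_le_left (Finset.sum_nonneg fun i _ => abs_nonneg (x i))]
  exact Finset.sum_sq_le_sq_sum_of_nonneg fun i _ => norm_nonneg (x i)

theorem EuclideanSpace.sum_abs_le {ι : Type*} [Fintype ι] (x : EuclideanSpace ℝ ι) :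
    ∑ i, |x i| ≤ Fintype.card ι * ‖x‖ := by
  rw [← nsmul_eq_mul, ← Finset.card_univ]
  exact Finset.sum_le_card_nsmul _ _ _ fun i _ => EuclideanSpace.abs_apply_le_norm x i

/-! ### The unit sphere -/

namespace UnitSphere

open OctPoint

/-- The unit sphere of Euclidean space of dimension three. -/
abbrev S2 : Set (EuclideanSpace ℝ (Fin 3)) := {x | ∑ i, x i ^ 2 = 1}

theorem mem_iff_norm {x : EuclideanSpace ℝ (Fin 3)} : x ∈ S2 ↔ ‖x‖ = 1 := by
  change ∑ i, x i ^ 2 = 1 ↔ _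
  rw [← EuclideanSpace.real_norm_sq_eq, pow_eq_one_iff_of_nonneg (norm_nonneg x) two_ne_zero]

/-- The radial projection to the octahedron of size `n`. -/
noncomputable def toOct (n : ℕ) (x : EuclideanSpace ℝ (Fin 3)) : Fin 3 → ℝ :=
  fun i => n * x i / ∑ j, |x j|

/-- The radial projection to the unit sphere. -/
noncomputable def ofOct (X : Fin 3 → ℝ) : EuclideanSpace ℝ (Fin 3) :=
  ‖WithLp.toLp 2 X‖⁻¹ • WithLp.toLp 2 X

theorem one_le_sum_abs {x : EuclideanSpace ℝ (Fin 3)} (hx : x ∈ S2) : 1 ≤ ∑ i, |x i| :=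
  mem_iff_norm.1 hx ▸ EuclideanSpace.norm_le_sum_abs x

variable {n : ℕ}

theorem sum_abs_toOct {x : EuclideanSpace ℝ (Fin 3)} (hx : x ∈ S2) :
    ∑ i, |toOct n x i| = n := by
  have h := one_le_sum_abs hx
  have h0 : 0 < ∑ i, |x i| := by linarith
  simp only [toOct, abs_div, abs_mul, Nat.abs_cast, abs_of_pos h0]
  rw [← Finset.sum_div, ← Finset.mul_sum, mul_div_cancel_right₀ _ h0.ne']

theorem toLp_ne_zero (hn : 0 < n) {X : Fin 3 → ℝ} (hX : ∑ i, |X i| = n) :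
    WithLp.toLp 2 X ≠ 0 := by
  intro h
  have h' : X = 0 := by simpa using h
  rw [h'] at hX
  simp only [Pi.zero_apply, abs_zero, Finset.sum_const_zero] at hX
  exact hn.ne (by exact_mod_cast hX)

theorem ofOct_mem (hn : 0 < n) {X : Fin 3 → ℝ} (hX : ∑ i, |X i| = n) : ofOct X ∈ S2 := by
  rw [mem_iff_norm, ofOct]
  exact norm_smul_inv_norm (𝕜 := ℝ) (toLp_ne_zero hn hX)

theorem toOct_ofOct (hn : 0 < n) {X : Fin 3 → ℝ} (hX : ∑ i, |X i| = n) :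
    toOct n (ofOct X) = X := by
  have h0 := norm_pos_iff.2 (toLp_ne_zero hn hX)
  have hn' : (n : ℝ) ≠ 0 := by exact_mod_cast hn.ne'
  ext i
  simp only [toOct, ofOct, PiLp.smul_apply, smul_eq_mul, abs_mul, abs_inv, abs_norm]
  rw [← Finset.mul_sum, hX]
  field_simp

theorem ofOct_toOct (hn : 0 < n) {x : EuclideanSpace ℝ (Fin 3)} (hx : x ∈ S2) :
    ofOct (toOct n x) = x := by
  have h := one_le_sum_abs hx
  have hn' : (0 : ℝ) < n := by exact_mod_cast hn
  have h1 : WithLp.toLp 2 (toOct n x) = ((n : ℝ) / ∑ j, |x j|) • x := by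
    ext i
    simp only [toOct, PiLp.smul_apply, smul_eq_mul]
    ring
  have h2 : (0 : ℝ) < n / ∑ j, |x j| := by positivity
  rw [ofOct, h1, norm_smul, mem_iff_norm.1 hx, mul_one, Real.norm_of_nonneg h2.le, smul_smul,
    inv_mul_cancel₀ h2.ne', one_smul]

theorem isClosed_S2 : IsClosed S2 := by
  have : S2 = Metric.sphere 0 1 := by
    ext x
    rw [mem_iff_norm, mem_sphere_zero_iff_norm]
  rw [this]
  exact Metric.isClosed_sphere

theorem continuousOn_toOct : ContinuousOn (toOct n) S2 := by
  refine continuousOn_pi.2 fun i => ContinuousOn.div (by fun_prop) (by fun_prop) fun x hx => ?_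
  linarith [one_le_sum_abs hx]

theorem tent_toOct_ofOct (hn : 0 < n) (v : OctPoint n) :
    v.tent (toOct n (ofOct (intVec v.1))) = 1 := by
  rw [toOct_ofOct hn (X := intVec v.1) v.sum_abs_cast]
  simp [tent]

theorem tentFamily (hn : 0 < n) :
    TentFamily S2 (fun (v : OctPoint n) x => v.tent (toOct n x)) 4 where
  isClosed := isClosed_S2
  continuousOn v := by
    have h : Continuous v.tent := by
      have : Continuous fun X : Fin 3 → ℝ =>
          max (1 - (∑ i, |(X - intVec v.1) i|) / 2) 0 := by fun_prop
      exact this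
    exact h.comp_continuousOn continuousOn_toOct
  nonneg v x _ := v.tent_nonneg _
  locallyFinite := locallyFinite_of_finite _
  partition x hx := by
    refine ⟨_, card_tent_pos_le (sum_abs_toOct hx), fun v hv => ?_, ?_⟩
    · by_contra h
      exact hv (Finset.mem_filter.2 ⟨Finset.mem_univ v, (v.tent_nonneg _).lt_of_ne (Ne.symm h)⟩)
    · rw [Finset.sum_filter_of_ne fun v _ h => (v.tent_nonneg _).lt_of_ne (Ne.symm h)]
      exact sum_tent (sum_abs_toOct hx)
  separates x hx y hy h := by
    rw [← ofOct_toOct hn hx, ← ofOct_toOct hn hy]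
    congr 1
    ext i
    rw [← sum_tent_mul_coord (sum_abs_toOct hx), ← sum_tent_mul_coord (sum_abs_toOct hy)]
    exact Finset.sum_congr rfl fun v _ => by rw [h v]
  realize s x₀ hx₀ hs t ht ht1 := by
    obtain ⟨X, hX, h⟩ := exists_le_tent (sum_abs_toOct hx₀) hs ht ht1
    refine ⟨ofOct X, ofOct_mem hn hX, fun v hv => ?_⟩
    rw [toOct_ofOct hn hX]
    exact h v hv
  peak v := ⟨_, ofOct_mem hn v.sum_abs_cast, tent_toOct_ofOct hn v⟩
  isBounded v := by
    refine (Metric.isBounded_sphere (x := 0) (r := 1)).subset fun x hx => ?_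
    rw [mem_sphere_zero_iff_norm, ← mem_iff_norm]
    exact hx.1

theorem dist_ofOct_lt (hn : 0 < n) (v : OctPoint n) {x : EuclideanSpace ℝ (Fin 3)} (hx : x ∈ S2)
    (h : 0 < v.tent (toOct n x)) : dist x (ofOct (intVec v.1)) < 12 / n := by
  have hn' : (0 : ℝ) < n := by exact_mod_cast hn
  have hv0 := toLp_ne_zero hn (X := intVec v.1) v.sum_abs_cast
  conv_lhs => rw [← ofOct_toOct hn hx]
  refine (dist_inv_norm_smul_le (toLp_ne_zero hn (sum_abs_toOct hx)) hv0).trans_lt ?_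
  have h1 := EuclideanSpace.norm_le_sum_abs
    (WithLp.toLp 2 (toOct n x) - WithLp.toLp 2 (intVec v.1))
  have h2 := tent_pos_iff.1 h
  rw [halfL1_apply] at h2
  simp only [PiLp.sub_apply, Pi.sub_apply] at h1 h2
  have h3 := EuclideanSpace.sum_abs_le (WithLp.toLp 2 (intVec v.1))
  have h4 : ∑ i, |(WithLp.toLp 2 (intVec v.1)) i| = n := v.sum_abs_cast
  rw [h4, Fintype.card_fin] at h3
  push_cast at h3
  rw [← dist_eq_norm] at h1
  -- The `ℓ¹` distance is below 2 and the lattice point has norm at least `n / 3`, so radial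
  -- projection gives `2 * 2 / (n / 3) = 12 / n`.
  rw [div_lt_div_iff₀ (norm_pos_iff.2 hv0) hn']
  nlinarith

/-- A concave function that is positive on one of the half-spaces bounding the cone over the open
star of `v`. -/
noncomputable def facet (v : OctPoint n) (J : Finset (Fin 3)) (x : EuclideanSpace ℝ (Fin 3)) : ℝ :=
  n * ∑ j ∈ J, (v.1 j).sign * x j - (∑ j ∈ J, |(v.1 j : ℝ)| - 1) * ∑ i, |x i|

theorem sum_abs_sub_one_nonneg (v : OctPoint n) {J : Finset (Fin 3)} (hJ : J.Nonempty)
    (hv : ∀ j ∈ J, v.1 j ≠ 0) : 0 ≤ ∑ j ∈ J, |(v.1 j : ℝ)| - 1 := by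
  obtain ⟨j, hj⟩ := hJ
  have h1 := Finset.single_le_sum (fun i _ => abs_nonneg (v.1 i : ℝ)) hj
  have h2 : (1 : ℝ) ≤ |(v.1 j : ℝ)| := by exact_mod_cast Int.one_le_abs (hv j hj)
  linarith

/-- The `ℓ¹` norm is convex, and its coefficient has the right sign because `J` contains a nonzero
coordinate of `v`. -/
theorem concaveOn_facet (v : OctPoint n) {J : Finset (Fin 3)} (hJ : J.Nonempty)
    (hv : ∀ j ∈ J, v.1 j ≠ 0) : ConcaveOn ℝ univ (facet v J) := by
  have hc := sum_abs_sub_one_nonneg v hJ hv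
  refine ⟨convex_univ, fun x _ y _ a b ha hb _ => ?_⟩
  have h1 : ∑ i, |(a • x + b • y) i| ≤ a * ∑ i, |x i| + b * ∑ i, |y i| := by
    rw [Finset.mul_sum, Finset.mul_sum, ← Finset.sum_add_distrib]
    refine Finset.sum_le_sum fun i _ => (abs_add_le _ _).trans_eq ?_
    simp [abs_mul, abs_of_nonneg ha, abs_of_nonneg hb]
  have h2 : ∑ j ∈ J, (v.1 j).sign * (a • x + b • y) j =
      a * ∑ j ∈ J, (v.1 j).sign * x j + b * ∑ j ∈ J, (v.1 j).sign * y j := by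
    rw [Finset.mul_sum, Finset.mul_sum, ← Finset.sum_add_distrib]
    refine Finset.sum_congr rfl fun j _ => ?_
    simp only [PiLp.add_apply, PiLp.smul_apply, smul_eq_mul]
    ring
  simp only [facet, smul_eq_mul, h2]
  nlinarith [mul_le_mul_of_nonneg_left h1 hc]

theorem abs_sign_le_one (k : ℤ) : |(k.sign : ℝ)| ≤ 1 := by
  rcases Int.sign_trichotomy k with h | h | h <;> simp [h]

theorem facet_sub_le (v : OctPoint n) {J : Finset (Fin 3)} (hJ : J.Nonempty)
    (hv : ∀ j ∈ J, v.1 j ≠ 0) (x y : EuclideanSpace ℝ (Fin 3)) :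
    facet v J x - facet v J y ≤ 6 * n * dist x y := by
  have hc := sum_abs_sub_one_nonneg v hJ hv
  have h1 := EuclideanSpace.sum_abs_le (x - y)
  rw [← dist_eq_norm, Fintype.card_fin] at h1
  simp only [PiLp.sub_apply] at h1
  have h2 : ∑ j ∈ J, (v.1 j).sign * x j - ∑ j ∈ J, (v.1 j).sign * y j ≤ ∑ i, |x i - y i| := by
    rw [← Finset.sum_sub_distrib]
    refine (Finset.sum_le_sum fun j _ => ?_).trans
      (Finset.sum_le_sum_of_subset_of_nonneg (Finset.subset_univ J) fun i _ _ => abs_nonneg _)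
    rw [← mul_sub]
    refine (le_abs_self _).trans ?_
    rw [abs_mul]
    exact mul_le_of_le_one_left (abs_nonneg _) (abs_sign_le_one _)
  have h3 : ∑ i, |y i| - ∑ i, |x i| ≤ ∑ i, |x i - y i| := by
    rw [← Finset.sum_sub_distrib]
    refine Finset.sum_le_sum fun i _ => ?_
    rw [abs_sub_comm]
    exact abs_sub_abs_le_abs_sub _ _
  have h4 : ∑ j ∈ J, |(v.1 j : ℝ)| - 1 ≤ n := by
    have := Finset.sum_le_sum_of_subset_of_nonneg (Finset.subset_univ J)
      fun i _ _ => abs_nonneg (v.1 i : ℝ)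
    rw [v.sum_abs_cast] at this
    linarith
  have h0 : 0 ≤ ∑ i, |x i - y i| := Finset.sum_nonneg fun i _ => abs_nonneg _
  have h5 := mul_le_mul_of_nonneg_left h2 (Nat.cast_nonneg (α := ℝ) n)
  have h6 := mul_le_mul_of_nonneg_left h3 hc
  have h7 := mul_le_mul_of_nonneg_right h4 h0
  have h8 := mul_le_mul_of_nonneg_left h1 (Nat.cast_nonneg (α := ℝ) n)
  push_cast at h8
  simp only [facet]
  linarith

theorem facet_eq (v : OctPoint n) (J : Finset (Fin 3)) {x : EuclideanSpace ℝ (Fin 3)}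
    (hx : x ∈ S2) : facet v J x =
      (∑ i, |x i|) * (1 - ∑ j ∈ J, (|(v.1 j : ℝ)| - (v.1 j).sign * toOct n x j)) := by
  have h := one_le_sum_abs hx
  have h0 : ∑ i, |x i| ≠ 0 := by linarith
  have h1 : ∑ j ∈ J, ((v.1 j).sign : ℝ) * toOct n x j =
      n * (∑ j ∈ J, (v.1 j).sign * x j) / ∑ i, |x i| := by
    rw [Finset.mul_sum, Finset.sum_div]
    refine Finset.sum_congr rfl fun j _ => ?_
    rw [toOct]
    ring
  rw [facet, Finset.sum_sub_distrib, h1]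
  field_simp
  ring

theorem sign_mul_eq_abs {k : ℤ} {a : ℝ} (h : 0 < a * k) : (k.sign : ℝ) * a = |a| := by
  rcases lt_trichotomy k 0 with hk | rfl | hk
  · have : (k : ℝ) < 0 := by exact_mod_cast hk
    rw [Int.sign_eq_neg_one_of_neg hk, abs_of_neg (by nlinarith)]
    simp
  · simp at h
  · have : (0 : ℝ) < k := by exact_mod_cast hk
    rw [Int.sign_eq_one_of_pos hk, abs_of_pos (pos_of_mul_pos_left h this.le)]
    simp

/-- Since the deficits `|v j| - |X j|` sum to zero, the deficit over `J` equals the excess over its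
complement, so it is at most half the `ℓ¹` distance, here at most `3 / 4`. The factor `∑ |x i|` in
`facet_eq` is at least one on the sphere. -/
theorem le_facet (v : OctPoint n) {J : Finset (Fin 3)} (hv : ∀ j ∈ J, v.1 j ≠ 0)
    {x : EuclideanSpace ℝ (Fin 3)} (hx : x ∈ S2) (h : 1 / 4 ≤ v.tent (toOct n x)) :
    1 / 4 ≤ facet v J x := by
  have hX := sum_abs_toOct (n := n) hx
  have h1 : halfL1 (Fin 3) (toOct n x - intVec v.1) ≤ 3 / 4 := by
    have := (le_max_iff.1 h).resolve_right (by norm_num)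
    linarith
  have h2 : ∑ j ∈ J, (|(v.1 j : ℝ)| - (v.1 j).sign * toOct n x j) =
      ∑ j ∈ J, (|(v.1 j : ℝ)| - |toOct n x j|) := Finset.sum_congr rfl fun j hj => by
    rw [sign_mul_eq_abs (mul_pos_of_halfL1_lt_one (hX.trans v.sum_abs_cast.symm)
      (h1.trans_lt (by norm_num)) (hv j hj))]
  have h3 : ∑ j ∈ J, (|(v.1 j : ℝ)| - |toOct n x j|) +
      ∑ j ∈ Jᶜ, (|(v.1 j : ℝ)| - |toOct n x j|) = 0 := by
    rw [Finset.sum_add_sum_compl, Finset.sum_sub_distrib, v.sum_abs_cast, hX, sub_self]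
  have h4 : ∑ j ∈ J, (|(v.1 j : ℝ)| - |toOct n x j|) ≤ ∑ j ∈ J, |toOct n x j - v.1 j| :=
    Finset.sum_le_sum fun j _ => by rw [abs_sub_comm]; exact abs_sub_abs_le_abs_sub _ _
  have h5 : ∑ j ∈ Jᶜ, (|toOct n x j| - |(v.1 j : ℝ)|) ≤ ∑ j ∈ Jᶜ, |toOct n x j - v.1 j| :=
    Finset.sum_le_sum fun j _ => abs_sub_abs_le_abs_sub _ _
  have h6 : ∑ j ∈ Jᶜ, (|toOct n x j| - |(v.1 j : ℝ)|) =
      -∑ j ∈ Jᶜ, (|(v.1 j : ℝ)| - |toOct n x j|) := by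
    rw [← Finset.sum_neg_distrib]
    exact Finset.sum_congr rfl fun j _ => (neg_sub _ _).symm
  have h7 := Finset.sum_add_sum_compl J fun j => |toOct n x j - v.1 j|
  rw [halfL1_apply] at h1
  simp only [Pi.sub_apply, intVec] at h1
  rw [facet_eq v J hx, h2]
  nlinarith [one_le_sum_abs hx]

/-- Singletons `J` force the signs of `X` to agree with those of `v`. Half the `ℓ¹` distance is then
the sum of the positive deficits, which is bounded by taking `J` to be the set where they occur. -/
theorem tent_pos_of_facet_pos (v : OctPoint n) {x : EuclideanSpace ℝ (Fin 3)} (hx : x ∈ S2)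
    (h : ∀ J : Finset (Fin 3), J.Nonempty → (∀ j ∈ J, v.1 j ≠ 0) → 0 < facet v J x) :
    0 < v.tent (toOct n x) := by
  have hX := sum_abs_toOct (n := n) hx
  have hP := one_le_sum_abs hx
  have hlt : ∀ J : Finset (Fin 3), J.Nonempty → (∀ j ∈ J, v.1 j ≠ 0) →
      ∑ j ∈ J, (|(v.1 j : ℝ)| - (v.1 j).sign * toOct n x j) < 1 := fun J h1 h2 => by
    have := h J h1 h2
    rw [facet_eq v J hx] at this
    linarith [pos_of_mul_pos_right this (by linarith)]
  have hs : ∀ j, v.1 j ≠ 0 → 0 < ((v.1 j).sign : ℝ) * toOct n x j := fun j hj => by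
    have h1 := hlt {j} (by simp) (by simpa using hj)
    rw [Finset.sum_singleton] at h1
    have h2 : (1 : ℝ) ≤ |(v.1 j : ℝ)| := by exact_mod_cast Int.one_le_abs hj
    linarith
  have hs' : ∀ j, v.1 j ≠ 0 → 0 < toOct n x j * v.1 j := fun j hj => by
    have h1 : (v.1 j : ℝ) = (v.1 j).sign * |(v.1 j : ℝ)| := by
      exact_mod_cast (Int.sign_mul_abs (v.1 j)).symm
    have h2 : (0 : ℝ) < |(v.1 j : ℝ)| := abs_pos.2 (by exact_mod_cast hj)
    rw [h1]
    have := mul_pos (hs j hj) h2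
    linarith
  have habs : ∀ j, |toOct n x j - v.1 j| = |(|(v.1 j : ℝ)| - |toOct n x j|)| := fun j => by
    by_cases hj : v.1 j = 0
    · simp [hj]
    · rw [abs_sub_comm]
      have h1 := hs' j hj
      rcases lt_or_gt_of_ne (show (v.1 j : ℝ) ≠ 0 by exact_mod_cast hj) with h2 | h2
      · have h3 : toOct n x j < 0 := by nlinarith
        rw [abs_of_neg h2, abs_of_neg h3, ← abs_neg]
        congr 1
        ring
      · have h3 : 0 < toOct n x j := pos_of_mul_pos_left h1 h2.le
        rw [abs_of_pos h2, abs_of_pos h3]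
  rw [tent_pos_iff, halfL1_apply]
  simp only [Pi.sub_apply, intVec, habs]
  set b : Fin 3 → ℝ := fun j => |(v.1 j : ℝ)| - |toOct n x j| with hb
  have hb0 : ∑ j, b j = 0 := by
    rw [hb, Finset.sum_sub_distrib, v.sum_abs_cast, hX, sub_self]
  have hbpos : ∑ j, |b j| = 2 * ∑ j ∈ Finset.univ.filter (fun j => 0 < b j), b j := by
    rw [Finset.sum_filter, Finset.mul_sum]
    have : ∑ j, |b j| = ∑ j, (|b j| + b j) := by
      rw [Finset.sum_add_distrib, hb0, add_zero]
    rw [this]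
    refine Finset.sum_congr rfl fun j _ => ?_
    split_ifs with hj
    · rw [abs_of_pos hj]; ring
    · rw [abs_of_nonpos (not_lt.1 hj)]; ring
  rw [hbpos, mul_div_cancel_left₀ _ two_ne_zero]
  have hJv : ∀ j ∈ Finset.univ.filter (fun j => 0 < b j), v.1 j ≠ 0 := fun j hj h0 => by
    have := (Finset.mem_filter.1 hj).2
    simp only [hb, h0, Int.cast_zero, abs_zero, zero_sub] at this
    linarith [abs_nonneg (toOct n x j)]
  rcases (Finset.univ.filter fun j => 0 < b j).eq_empty_or_nonempty with h0 | h0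
  · rw [h0, Finset.sum_empty]
    exact one_pos
  · have := hlt _ h0 hJv
    rwa [Finset.sum_congr rfl fun j hj => by rw [sign_mul_eq_abs (hs' j (hJv j hj))]] at this

theorem isNicelyTriangulable : IsNicelyTriangulable S2 := by
  refine ⟨1, one_pos, 1 / 1000, by norm_num, fun ρ hρ hρ1 => ?_⟩
  -- The lower bound makes the tent radius `12 / n` less than `ρ`; the upper bound gives `L * δ = 6
  -- * n * ρ / 1000 ≤ 78 / 1000 < 1 / 4`.
  obtain ⟨n, hn1, hn2⟩ : ∃ n : ℕ, 12 / ρ < n ∧ (n : ℝ) ≤ 13 / ρ := by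
    refine ⟨⌊12 / ρ⌋₊ + 1, by exact_mod_cast Nat.lt_floor_add_one (12 / ρ), ?_⟩
    have h1 := Nat.floor_le (show 0 ≤ 12 / ρ by positivity)
    have h2 : 1 ≤ 1 / ρ := by rw [le_div_iff₀ hρ]; linarith
    have h3 : 13 / ρ = 12 / ρ + 1 / ρ := by ring
    push_cast
    linarith
  have hn0 : (0 : ℝ) < n := (by positivity : 0 < 12 / ρ).trans hn1
  have hn : 0 < n := by exact_mod_cast hn0
  have H := tentFamily hn
  refine ⟨OctPoint n, H.complex, H.homeomorph.symm, TentFamily.cell S2 _,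
    H.isNiceTriangulation (c := 1 / 4) (L := 6 * n)
      (κ := fun v => {J : Finset (Fin 3) // J.Nonempty ∧ ∀ j ∈ J, v.1 j ≠ 0}) hρ (by positivity)
      ?_ (fun v => ofOct (intVec v.1)) (fun v => ofOct_mem hn v.sum_abs_cast)
      (fun v => tent_toOct_ofOct hn v) (fun v x hx h => (dist_ofOct_lt hn v hx h).trans ?_)
      (fun v J => facet v J.1) (fun v J => concaveOn_facet v J.2.1 J.2.2)
      (fun v J => facet_sub_le v J.2.1 J.2.2) (by positivity)
      (fun v J x hx h => le_facet v J.2.2 hx (by exact_mod_cast h))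
      (fun v x hx h => tent_pos_of_facet_pos v hx fun J h1 h2 => h ⟨J, h1, h2⟩)⟩
  · have : (n : ℝ) * ρ ≤ 13 := by rwa [le_div_iff₀ hρ] at hn2
    linarith
  · rw [div_lt_iff₀ hn0]
    rw [div_lt_iff₀ hρ] at hn1
    linarith

end UnitSphere

/-! ### The flat torus: periodic Kuhn tents -/

namespace FlatTorus

/-- The flat torus in Euclidean space of dimension four. -/
abbrev T2 : Set (EuclideanSpace ℝ (Fin 4)) :=
  {x | x 0 ^ 2 + x 1 ^ 2 = 1 ∧ x 2 ^ 2 + x 3 ^ 2 = 1}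

/-- The two complex coordinates of a point of Euclidean space of dimension four. -/
def cpx (x : EuclideanSpace ℝ (Fin 4)) (i : Fin 2) : ℂ := ⟨x (![0, 2] i), x (![1, 3] i)⟩

/-- The point with complex coordinates on the unit circle. -/
noncomputable def ofCircle (c : Fin 2 → Circle) : EuclideanSpace ℝ (Fin 4) :=
  !₂[(c 0 : ℂ).re, (c 0 : ℂ).im, (c 1 : ℂ).re, (c 1 : ℂ).im]

theorem cpx_ofCircle (c : Fin 2 → Circle) (i : Fin 2) : cpx (ofCircle c) i = c i := by
  fin_cases i <;> rfl

theorem cpx_injective {x y : EuclideanSpace ℝ (Fin 4)} (h : ∀ i, cpx x i = cpx y i) : x = y := by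
  have h0 := Complex.ext_iff.1 (h 0)
  have h1 := Complex.ext_iff.1 (h 1)
  ext i
  fin_cases i
  exacts [h0.1, h0.2, h1.1, h1.2]

theorem norm_cpx_sq (x : EuclideanSpace ℝ (Fin 4)) (i : Fin 2) :
    ‖cpx x i‖ ^ 2 = x (![0, 2] i) ^ 2 + x (![1, 3] i) ^ 2 := by
  rw [Complex.sq_norm, Complex.normSq_apply, sq, sq]
  rfl

theorem norm_sq_eq (x : EuclideanSpace ℝ (Fin 4)) : ‖x‖ ^ 2 = ‖cpx x 0‖ ^ 2 + ‖cpx x 1‖ ^ 2 := by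
  rw [norm_cpx_sq, norm_cpx_sq, EuclideanSpace.real_norm_sq_eq, Fin.sum_univ_four, add_assoc]
  rfl

theorem norm_cpx_le (x : EuclideanSpace ℝ (Fin 4)) (i : Fin 2) : ‖cpx x i‖ ≤ ‖x‖ := by
  refine (pow_le_pow_iff_left₀ (norm_nonneg _) (norm_nonneg _) two_ne_zero).1 ?_
  rw [norm_sq_eq]
  fin_cases i
  · exact le_add_of_nonneg_right (sq_nonneg _)
  · exact le_add_of_nonneg_left (sq_nonneg _)

theorem cpx_sub (x y : EuclideanSpace ℝ (Fin 4)) (i : Fin 2) :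
    cpx (x - y) i = cpx x i - cpx y i := rfl

theorem continuous_cpx (i : Fin 2) : Continuous fun x => cpx x i := by
  have h : (fun x => cpx x i) = fun x : EuclideanSpace ℝ (Fin 4) =>
      (x (![0, 2] i) : ℂ) + x (![1, 3] i) * Complex.I := by
    ext x
    exact Complex.mk_eq_add_mul_I _ _
  rw [h]
  fun_prop

theorem norm_cpx {x : EuclideanSpace ℝ (Fin 4)} (hx : x ∈ T2) (i : Fin 2) : ‖cpx x i‖ = 1 := by
  rw [← pow_eq_one_iff_of_nonneg (norm_nonneg _) two_ne_zero, norm_cpx_sq]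
  fin_cases i
  exacts [hx.1, hx.2]

theorem ofCircle_mem (c : Fin 2 → Circle) : ofCircle c ∈ T2 := by
  have h : ∀ i, ‖cpx (ofCircle c) i‖ ^ 2 = 1 := fun i => by
    rw [cpx_ofCircle, Circle.norm_coe, one_pow]
  exact ⟨norm_cpx_sq (ofCircle c) 0 ▸ h 0, norm_cpx_sq (ofCircle c) 1 ▸ h 1⟩

/-- The angle from `a` to `z`, in units of `2π / n`. -/
noncomputable def turn (n : ℕ) (z : ℂ) (a : Circle) : ℝ :=
  n / (2 * Real.pi) * Complex.arg (z * (a⁻¹ : Circle))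

/-- The point of the unit circle at angle `y`, in units of `2π / n`. -/
noncomputable def circlePt (n : ℕ) (y : ℝ) : Circle := Circle.exp (2 * Real.pi / n * y)

variable {n : ℕ}

theorem turn_circlePt (hn : 0 < n) {y w : ℝ} (h : |y - w| < n / 2) :
    turn n (circlePt n y) (circlePt n w) = y - w := by
  have hn' : (0 : ℝ) < n := by exact_mod_cast hn
  have hpi := Real.pi_pos
  obtain ⟨h1, h2⟩ := abs_lt.1 h
  have e : 2 * Real.pi / n * (n / 2) = Real.pi := by field_simp
  have hc : 0 < 2 * Real.pi / n := by positivity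
  have h3 := mul_lt_mul_of_pos_left h1 hc
  have h4 := mul_lt_mul_of_pos_left h2 hc
  rw [turn, ← Circle.coe_mul, ← div_eq_mul_inv, circlePt, circlePt, ← Circle.exp_sub, ← mul_sub,
    Circle.arg_exp (by linarith) (by linarith)]
  field_simp

theorem circlePt_sub (y w : ℝ) : circlePt n (y - w) = circlePt n y / circlePt n w := by
  rw [circlePt, mul_sub, Circle.exp_sub]
  rfl

theorem circlePt_turn (hn : 0 < n) (c a : Circle) : circlePt n (turn n c a) = c / a := by
  have hn' : (n : ℝ) ≠ 0 := by exact_mod_cast hn.ne'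
  have hpi := Real.pi_pos.ne'
  rw [turn, circlePt, ← Circle.coe_mul, ← mul_assoc,
    show 2 * Real.pi / n * (n / (2 * Real.pi)) = 1 by field_simp, one_mul, Circle.exp_arg]
  rfl

theorem circlePt_pow_eq_one (hn : 0 < n) {y : ℝ} : circlePt n y ^ n = 1 ↔ ∃ k : ℤ, y = k := by
  have hn' : (n : ℝ) ≠ 0 := by exact_mod_cast hn.ne'
  have hpi := Real.pi_pos.ne'
  rw [circlePt, ← Circle.exp_natCast_mul, Circle.exp_eq_one]
  refine exists_congr fun k => ?_
  rw [← mul_assoc, mul_div_cancel₀ _ hn', mul_comm]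
  exact mul_left_inj' (by positivity)

theorem exists_turn_eq (hn : 0 < n) (y : ℝ) {a : Circle} (ha : a ^ n = 1) :
    ∃ w : ℤ, turn n (circlePt n y) a = y - w ∧ a = circlePt n w := by
  have h : circlePt n (y - turn n (circlePt n y) a) = a := by
    rw [circlePt_sub, circlePt_turn hn, div_div_cancel]
  obtain ⟨k, hk⟩ := (circlePt_pow_eq_one hn).1 (h.symm ▸ ha)
  exact ⟨k, by rw [← hk]; ring, by rw [← hk, h]⟩

/-- The pairs of `n`-th roots of unity. -/
abbrev GridPoint (n : ℕ) : Type := {a : Fin 2 → Circle // ∀ i, a i ^ n = 1}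

theorem finite_gridPoint (hn : 0 < n) : Finite (GridPoint n) := by
  have h1 : {c : Circle | c ^ n = 1}.Finite := by
    refine Set.Finite.of_finite_image (f := fun c : Circle => (c : ℂ)) ?_
      Circle.coe_injective.injOn
    refine (Polynomial.nthRoots n (1 : ℂ)).toFinset.finite_toSet.subset ?_
    rintro _ ⟨c, hc, rfl⟩
    simp only [Finset.mem_coe, Multiset.mem_toFinset, Polynomial.mem_nthRoots hn]
    exact_mod_cast congrArg (fun c : Circle => (c : ℂ)) (show c ^ n = 1 from hc)
  exact (Set.Finite.pi' fun _ : Fin 2 => h1).to_subtype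

/-- The position of `x` relative to a grid point. -/
noncomputable def relPos (v : GridPoint n) (x : EuclideanSpace ℝ (Fin 4)) : Fin 2 → ℝ :=
  fun i => turn n (cpx x i) (v.1 i)

/-- The tent function of a grid point. -/
noncomputable def tent (v : GridPoint n) (x : EuclideanSpace ℝ (Fin 4)) : ℝ :=
  max (1 - spread (Fin 2) (relPos v x)) 0

theorem tent_pos_iff {v : GridPoint n} {x : EuclideanSpace ℝ (Fin 4)} :
    0 < tent v x ↔ spread (Fin 2) (relPos v x) < 1 := by
  simp [tent]

theorem tent_nonneg (v : GridPoint n) (x : EuclideanSpace ℝ (Fin 4)) : 0 ≤ tent v x :=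
  le_max_right _ _

/-- The point of the torus with given angles, in units of `2π / n`. -/
noncomputable def torusPt (n : ℕ) (y : Fin 2 → ℝ) : EuclideanSpace ℝ (Fin 4) :=
  ofCircle fun i => circlePt n (y i)

theorem cpx_torusPt (y : Fin 2 → ℝ) (i : Fin 2) : cpx (torusPt n y) i = circlePt n (y i) :=
  cpx_ofCircle _ i

theorem torusPt_mem (y : Fin 2 → ℝ) : torusPt n y ∈ T2 := ofCircle_mem _

theorem exists_circle_eq {x : EuclideanSpace ℝ (Fin 4)} (hx : x ∈ T2) :
    ∃ c : Fin 2 → Circle, ∀ i, cpx x i = c i :=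
  ⟨fun i => ⟨cpx x i, mem_sphere_zero_iff_norm.2 (norm_cpx hx i)⟩, fun _ => rfl⟩

theorem torusPt_add_turn (hn : 0 < n) (v : GridPoint n) {u : Fin 2 → ℤ}
    (hu : ∀ i, v.1 i = circlePt n (u i)) {x : EuclideanSpace ℝ (Fin 4)} (hx : x ∈ T2) :
    torusPt n (fun i => u i + turn n (cpx x i) (v.1 i)) = x := by
  obtain ⟨c, hc⟩ := exists_circle_eq hx
  refine cpx_injective fun i => ?_
  have h : circlePt n (u i + turn n (cpx x i) (v.1 i)) = c i := by
    rw [hc, ← sub_neg_eq_add, circlePt_sub, ← zero_sub, circlePt_sub, circlePt_turn hn, ← hu,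
      div_div_eq_mul_div, circlePt, mul_zero, Circle.exp_zero]
    simp
  rw [cpx_torusPt, h, hc]

theorem exists_torusPt_eq (hn : 0 < n) {x : EuclideanSpace ℝ (Fin 4)} (hx : x ∈ T2) :
    ∃ y, torusPt n y = x :=
  ⟨_, torusPt_add_turn hn ⟨fun _ => 1, fun _ => one_pow n⟩ (u := 0)
    (fun _ => by simp [circlePt]) hx⟩

/-- Near a point of the torus, the grid points lift to integer points of the plane. -/
theorem exists_lift (hn : 2 < n) (y : Fin 2 → ℝ) : ∃ e : GridPoint n → Fin 2 → ℤ,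
    (∀ v, relPos v (torusPt n y) = y - intVec (e v)) ∧ (∀ v i, v.1 i = circlePt n (e v i)) ∧
    ∀ w, 0 < kuhnTent w y → ∃ v, e v = w := by
  have hn0 : 0 < n := by omega
  have hn2 : (2 : ℝ) < n := by exact_mod_cast hn
  choose e he1 he2 using fun (v : GridPoint n) (i : Fin 2) => exists_turn_eq hn0 (y i) (v.2 i)
  refine ⟨e, fun v => funext fun i => ?_, he2, fun w hw => ?_⟩
  · rw [relPos, cpx_torusPt, he1]
    rfl
  · let v : GridPoint n := ⟨fun i => circlePt n (w i),
      fun i => (circlePt_pow_eq_one hn0).2 ⟨w i, rfl⟩⟩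
    refine ⟨v, funext fun i => ?_⟩
    have h1 := he1 v i
    have h2 := abs_sub_lt_one_of_spread (kuhnTent_pos_iff.1 hw) i
    rw [turn_circlePt hn0 (by linarith)] at h1
    exact_mod_cast (sub_right_injective h1).symm

theorem tent_eq_of_lift {y : Fin 2 → ℝ} {e : Fin 2 → ℤ} {v : GridPoint n}
    (h : relPos v (torusPt n y) = y - intVec e) : tent v (torusPt n y) = kuhnTent e y := by
  rw [tent, h]
  rfl

theorem lift_injective {e : GridPoint n → Fin 2 → ℤ} (h : ∀ v i, v.1 i = circlePt n (e v i)) :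
    Function.Injective e := fun u v huv =>
  Subtype.ext (funext fun i => by rw [h u i, h v i, huv])

theorem int_eq_of_circlePt_eq (hn : 0 < n) {k l : ℤ} (h : circlePt n k = circlePt n l)
    (hkl : |(k : ℝ) - l| < n / 2) : k = l := by
  have h1 := turn_circlePt hn hkl
  have h2 := turn_circlePt (n := n) hn (y := l) (w := l) (by
    rw [sub_self, abs_zero]
    have : (0 : ℝ) < n := by exact_mod_cast hn
    positivity)
  rw [h, h2, sub_self] at h1
  exact_mod_cast (sub_eq_zero.1 h1.symm)

/-- The lifts of one grid point seen from `y` and from `z` are linked by a chain of four steps of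
length below one through `y`, `u`, `z`. They differ by less than `4 ≤ n / 2`, so they coincide. -/
theorem kuhnTent_eq_of_tent_eq (hn : 8 ≤ n) {y z : Fin 2 → ℝ}
    {v₀ : GridPoint n} (hv₀ : 0 < tent v₀ (torusPt n y))
    {u : Fin 2 → ℤ} (hy : relPos v₀ (torusPt n y) = y - intVec u)
    (hz : relPos v₀ (torusPt n z) = z - intVec u)
    (h : ∀ v : GridPoint n, tent v (torusPt n y) = tent v (torusPt n z)) (w : Fin 2 → ℤ)
    (hw : 0 < kuhnTent w y) : kuhnTent w y = kuhnTent w z := by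
  have hn8 : (8 : ℝ) ≤ n := by exact_mod_cast hn
  have hn0 : 0 < n := by omega
  obtain ⟨e, he1, he2, he3⟩ := exists_lift (n := n) (by omega) y
  obtain ⟨f, hf1, hf2, -⟩ := exists_lift (n := n) (by omega) z
  obtain ⟨v, rfl⟩ := he3 w hw
  have h1 := tent_eq_of_lift (he1 v)
  have h2 := tent_eq_of_lift (hf1 v)
  have hef : e v = f v := funext fun i => by
    refine int_eq_of_circlePt_eq hn0 ((he2 v i).symm.trans (hf2 v i)) ?_
    have a1 := abs_lt.1 (abs_sub_lt_one_of_spread (kuhnTent_pos_iff.1 hw) i)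
    have a2 := abs_lt.1 (abs_sub_lt_one_of_spread
      (kuhnTent_pos_iff.1 (by rw [← h2, ← h v, h1]; exact hw)) i)
    have a3 := abs_lt.1 (abs_sub_lt_one_of_spread
      (kuhnTent_pos_iff.1 (by rw [← tent_eq_of_lift hy]; exact hv₀)) i)
    have a4 := abs_lt.1 (abs_sub_lt_one_of_spread
      (kuhnTent_pos_iff.1 (by rw [← tent_eq_of_lift hz, ← h]; exact hv₀)) i)
    exact abs_lt.2 ⟨by linarith, by linarith⟩
  rw [← h1, h v, h2, hef]

/-- The argument jumps only on the negative axis. There the angle exceeds a quarter turn, hence `n /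
4 ≥ 1` units, and the tent vanishes nearby. -/
theorem continuousAt_tent (hn : 4 ≤ n) (v : GridPoint n) {x : EuclideanSpace ℝ (Fin 4)}
    (hx : x ∈ T2) : ContinuousAt (tent v) x := by
  have hc : ∀ i, Continuous fun x => cpx x i * ((v.1 i)⁻¹ : Circle) := fun i =>
    (continuous_cpx i).mul continuous_const
  by_cases h : ∀ i, cpx x i * ((v.1 i)⁻¹ : Circle) ∈ Complex.slitPlane
  · refine ContinuousAt.sup (continuousAt_const.sub ?_) continuousAt_const
    refine spread_continuous.continuousAt.comp (continuousAt_pi.2 fun i => ?_)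
    exact continuousAt_const.mul
      ((Complex.continuousAt_arg (h i)).comp (f := fun x => cpx x i * ((v.1 i)⁻¹ : Circle))
        (hc i).continuousAt)
  · push Not at h
    obtain ⟨i, hi⟩ := h
    have h1 : ‖cpx x i * ((v.1 i)⁻¹ : Circle)‖ = 1 := by
      rw [norm_mul, norm_cpx hx, Circle.norm_coe, one_mul]
    have hre : (cpx x i * ((v.1 i)⁻¹ : Circle)).re < 0 := by
      rw [Complex.mem_slitPlane_iff, not_or, not_lt, not_not] at hi
      refine hi.1.lt_of_ne fun h0 => ?_
      rw [show cpx x i * ((v.1 i)⁻¹ : Circle) = 0 from Complex.ext h0 hi.2, norm_zero] at h1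
      exact zero_ne_one h1
    have hev : ∀ᶠ z in 𝓝 x, tent v z = 0 := by
      filter_upwards [(Complex.continuous_re.comp (hc i)).continuousAt.eventually_lt
        continuousAt_const hre] with z hz
      by_contra hne
      have h2 := abs_le_spread (relPos v z) i
      have h3 := tent_pos_iff.1 ((tent_nonneg v z).lt_of_ne (Ne.symm hne))
      have h4 : Real.pi / 2 < |Complex.arg (cpx z i * ((v.1 i)⁻¹ : Circle))| :=
        not_le.1 fun hle => (Complex.abs_arg_le_pi_div_two_iff.1 hle).not_gt hz
      have hn4 : (4 : ℝ) ≤ n := by exact_mod_cast hn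
      have hpi := Real.pi_pos
      rw [relPos, turn, abs_mul, abs_of_nonneg (by positivity)] at h2
      have h5 : (n : ℝ) / (2 * Real.pi) * (Real.pi / 2) = n / 4 := by field_simp; norm_num
      have h6 := mul_lt_mul_of_pos_left h4 (show 0 < (n : ℝ) / (2 * Real.pi) by positivity)
      linarith
    exact continuousAt_const.congr (hev.mono fun z hz => hz.symm)

theorem exists_partition (hn : 2 < n) {x : EuclideanSpace ℝ (Fin 4)} (hx : x ∈ T2) :
    ∃ S : Finset (GridPoint n), S.card ≤ 4 ∧ (∀ v ∉ S, tent v x = 0) ∧ ∑ v ∈ S, tent v x = 1 := by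
  classical
  obtain ⟨y, rfl⟩ := exists_torusPt_eq (by omega : 0 < n) hx
  obtain ⟨e, he1, he2, he3⟩ := exists_lift hn y
  have hinj := lift_injective he2
  refine ⟨(kuhnBox y).preimage e hinj.injOn, ?_, fun v hv => ?_, ?_⟩
  · refine (Finset.card_le_card_of_injOn e (t := kuhnBox y)
      (fun v hv => Finset.mem_preimage.1 hv) hinj.injOn).trans ?_
    rw [card_kuhnBox]
    simp
  · rw [tent_eq_of_lift (he1 v)]
    exact kuhnTent_eq_zero fun h => hv (Finset.mem_preimage.2 h)
  · rw [← sum_kuhnTent y, ← Finset.sum_preimage e (kuhnBox y) hinj.injOn (fun w => kuhnTent w y)]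
    · exact Finset.sum_congr rfl fun v _ => tent_eq_of_lift (he1 v)
    · intro w _ hw
      by_contra h
      exact hw (he3 w ((kuhnTent_nonneg w y).lt_of_ne (Ne.symm h)))

/-- A grid point active at `x` is active at `y` too, so both points lift to one planar chart, where
the Kuhn tents separate points. -/
theorem tent_separates (hn : 8 ≤ n) {x y : EuclideanSpace ℝ (Fin 4)} (hx : x ∈ T2) (hy : y ∈ T2)
    (h : ∀ v : GridPoint n, tent v x = tent v y) : x = y := by
  have hn0 : 0 < n := by omega
  obtain ⟨v, hv⟩ : ∃ v : GridPoint n, 0 < tent v x := by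
    obtain ⟨S, -, -, h1⟩ := exists_partition (by omega : 2 < n) hx
    by_contra! h0
    have : ∑ v ∈ S, tent v x = 0 :=
      Finset.sum_eq_zero fun v _ => (h0 v).antisymm (tent_nonneg v x)
    linarith
  obtain ⟨a, rfl⟩ := exists_torusPt_eq hn0 hx
  obtain ⟨e, he1, he2, -⟩ := exists_lift (n := n) (by omega) a
  obtain ⟨b, rfl, hb⟩ : ∃ b, torusPt n b = y ∧ relPos v y = b - intVec (e v) :=
    ⟨_, torusPt_add_turn hn0 v (he2 v) hy, by ext i; simp [relPos, intVec]⟩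
  congr 1
  refine kuhnTent_injective fun w => ?_
  rcases (kuhnTent_nonneg w a).eq_or_lt with ha | ha
  · rcases (kuhnTent_nonneg w b).eq_or_lt with hb' | hb'
    · rw [← ha, ← hb']
    · exact (kuhnTent_eq_of_tent_eq hn (h v ▸ hv) hb (he1 v) (fun v => (h v).symm) w hb').symm
  · exact kuhnTent_eq_of_tent_eq hn hv (he1 v) hb h w ha

theorem relPos_self (v : GridPoint n) : relPos v (ofCircle v.1) = 0 := by
  ext i
  rw [relPos, turn, cpx_ofCircle, ← Circle.coe_mul, mul_inv_cancel]
  simp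

theorem tent_self (v : GridPoint n) : tent v (ofCircle v.1) = 1 := by
  simp [tent, relPos_self]

theorem norm_le_two_of_mem {x : EuclideanSpace ℝ (Fin 4)} (hx : x ∈ T2) : ‖x‖ ≤ 2 := by
  refine (pow_le_pow_iff_left₀ (norm_nonneg _) zero_le_two two_ne_zero).1 ?_
  rw [norm_sq_eq, norm_cpx hx, norm_cpx hx]
  norm_num

theorem tentFamily (hn : 8 ≤ n) : TentFamily T2 (fun v : GridPoint n => tent v) 4 where
  isClosed := by
    refine IsClosed.inter (isClosed_eq ?_ continuous_const) (isClosed_eq ?_ continuous_const) <;>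
    fun_prop
  continuousOn v x hx := (continuousAt_tent (by omega) v hx).continuousWithinAt
  nonneg v x _ := tent_nonneg v x
  locallyFinite := by
    have := finite_gridPoint (by omega : 0 < n)
    exact locallyFinite_of_finite _
  partition x hx := exists_partition (by omega) hx
  separates x hx y hy h := tent_separates hn hx hy h
  realize s x₀ hx₀ hs t ht ht1 := by
    have hn0 : 0 < n := by omega
    have hn8 : (8 : ℝ) ≤ n := by exact_mod_cast hn
    obtain ⟨y, rfl⟩ := exists_torusPt_eq hn0 hx₀
    obtain ⟨e, he1, he2, -⟩ := exists_lift (by omega : 2 < n) y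
    refine ⟨_, torusPt_mem (n := n) (∑ w ∈ s, t w • intVec (e w)), fun v hv => ?_⟩
    have h1 := spread_barycenter_sub_le (y₀ := y)
      (fun v hv => kuhnTent_pos_iff.1 (tent_eq_of_lift (he1 v) ▸ hs v hv)) ht ht1 hv
    refine le_max_of_le_left ?_
    have h2 : relPos v (torusPt n (∑ w ∈ s, t w • intVec (e w))) =
        ∑ w ∈ s, t w • intVec (e w) - intVec (e v) := by
      ext i
      -- The barycentre is within one unit of each lift, less than half a turn, so the angle does
      -- not wrap around.
      rw [relPos, cpx_torusPt, he2, turn_circlePt hn0]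
      · rfl
      · have := (abs_le_spread _ i).trans h1
        rw [Pi.sub_apply] at this
        have h3 := ht v
        refine lt_of_le_of_lt this ?_
        linarith
    rw [h2]
    linarith
  peak v := ⟨_, ofCircle_mem v.1, tent_self v⟩
  isBounded v := by
    refine (Metric.isBounded_closedBall (x := 0) (r := 2)).subset fun x hx => ?_
    rw [mem_closedBall_zero_iff]
    exact norm_le_two_of_mem hx.1

end FlatTorus

/-! ### The flat torus: concave functions from sines and cosines -/

namespace FlatTorus

variable {n : ℕ}

/-- The linear approximation of `relPos`, the sine of the angle in place of the angle. -/
noncomputable def sinePos (v : GridPoint n) : EuclideanSpace ℝ (Fin 4) →ₗ[ℝ] (Fin 2 → ℝ) where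
  toFun x i := n / (2 * Real.pi) * (cpx x i * ((v.1 i)⁻¹ : Circle)).im
  map_add' x y := by
    ext i
    simp only [Complex.mul_im, Pi.add_apply]
    change _ * ((x _ + y _) * _ + (x _ + y _) * _) = _ * (x _ * _ + x _ * _) + _ * (y _ * _ + y _ * _)
    ring
  map_smul' a x := by
    ext i
    simp only [Complex.mul_im, Pi.smul_apply, smul_eq_mul, RingHom.id_apply]
    change _ * ((a * x _) * _ + (a * x _) * _) = a * (_ * (x _ * _ + x _ * _))
    ring

/-- The cosine of the angle between a point and a grid point. -/
noncomputable def cosine (v : GridPoint n) (i : Fin 2) : EuclideanSpace ℝ (Fin 4) →ₗ[ℝ] ℝ where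
  toFun x := (cpx x i * ((v.1 i)⁻¹ : Circle)).re
  map_add' x y := by
    simp only [Complex.mul_re]
    change (x _ + y _) * _ - (x _ + y _) * _ = x _ * _ - x _ * _ + (y _ * _ - y _ * _)
    ring
  map_smul' a x := by
    simp only [Complex.mul_re, smul_eq_mul, RingHom.id_apply]
    change (a * x _) * _ - (a * x _) * _ = a * (x _ * _ - x _ * _)
    ring

theorem sinePos_apply (v : GridPoint n) (x : EuclideanSpace ℝ (Fin 4)) (i : Fin 2) :
    sinePos v x i = n / (2 * Real.pi) * (cpx x i * ((v.1 i)⁻¹ : Circle)).im := rfl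

theorem cosine_apply (v : GridPoint n) (i : Fin 2) (x : EuclideanSpace ℝ (Fin 4)) :
    cosine v i x = (cpx x i * ((v.1 i)⁻¹ : Circle)).re := rfl

theorem norm_mul_le (v : GridPoint n) (x : EuclideanSpace ℝ (Fin 4)) (i : Fin 2) :
    ‖cpx x i * ((v.1 i)⁻¹ : Circle)‖ ≤ ‖x‖ := by
  rw [norm_mul, Circle.norm_coe, mul_one]
  exact norm_cpx_le x i

theorem spread_sinePos_le (v : GridPoint n) (x : EuclideanSpace ℝ (Fin 4)) :
    spread (Fin 2) (sinePos v x) ≤ n * ‖x‖ := by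
  have hpi := Real.pi_gt_three
  refine (spread_le_two_mul_norm _).trans ?_
  have h : ‖sinePos v x‖ ≤ n / 2 * ‖x‖ := by
    refine (pi_norm_le_iff_of_nonneg (by positivity)).2 fun i => ?_
    rw [sinePos_apply, norm_mul, Real.norm_of_nonneg (by positivity)]
    refine mul_le_mul (div_le_div_of_nonneg_left (by positivity) (by positivity) (by linarith))
      ((Complex.abs_im_le_norm _).trans (norm_mul_le v x i)) (norm_nonneg _) (by positivity)
  linarith

theorem abs_cosine_le (v : GridPoint n) (i : Fin 2) (x : EuclideanSpace ℝ (Fin 4)) :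
    |cosine v i x| ≤ ‖x‖ := (Complex.abs_re_le_norm _).trans (norm_mul_le v x i)

theorem relPos_eq (v : GridPoint n) (x : EuclideanSpace ℝ (Fin 4)) (i : Fin 2) :
    relPos v x i = n / (2 * Real.pi) * Complex.arg (cpx x i * ((v.1 i)⁻¹ : Circle)) := rfl

theorem norm_mul_eq_one (v : GridPoint n) {x : EuclideanSpace ℝ (Fin 4)} (hx : x ∈ T2)
    (i : Fin 2) : ‖cpx x i * ((v.1 i)⁻¹ : Circle)‖ = 1 := by
  rw [norm_mul, Circle.norm_coe, mul_one, norm_cpx hx]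

theorem sinePos_eq (v : GridPoint n) {x : EuclideanSpace ℝ (Fin 4)} (hx : x ∈ T2) (i : Fin 2) :
    sinePos v x i =
      n / (2 * Real.pi) * Real.sin (Complex.arg (cpx x i * ((v.1 i)⁻¹ : Circle))) := by
  rw [Complex.sin_arg, norm_mul_eq_one v hx, div_one, sinePos_apply]

theorem cosine_eq (v : GridPoint n) {x : EuclideanSpace ℝ (Fin 4)} (hx : x ∈ T2) (i : Fin 2) :
    cosine v i x = Real.cos (Complex.arg (cpx x i * ((v.1 i)⁻¹ : Circle))) := by
  have h1 := norm_mul_eq_one v hx i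
  rw [Complex.cos_arg (norm_ne_zero_iff.1 (h1 ▸ one_ne_zero)), h1, div_one, cosine_apply]

/-- The error of the sine is at most `|θ| ^ 3 / 6`; scaled by `n / (2 * π)` with `|θ| ≤ 10 / n` it
is of order `1 / n ^ 2`. -/
theorem abs_relPos_sub_sinePos_le (hn : 100 ≤ n) (v : GridPoint n)
    {x : EuclideanSpace ℝ (Fin 4)} (hx : x ∈ T2) {i : Fin 2}
    (h : |Complex.arg (cpx x i * ((v.1 i)⁻¹ : Circle))| ≤ 10 / n) :
    |relPos v x i - sinePos v x i| ≤ 1 / 32 := by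
  have hn' : (100 : ℝ) ≤ n := by exact_mod_cast hn
  have hpi := Real.pi_gt_three
  rw [relPos_eq, sinePos_eq v hx, ← mul_sub, abs_mul, abs_of_nonneg (by positivity)]
  have h1 := (Real.abs_sub_sin_le (Complex.arg (cpx x i * ((v.1 i)⁻¹ : Circle)))).trans
    (div_le_div_of_nonneg_right (pow_le_pow_left₀ (abs_nonneg _) h 3) (by norm_num))
  have h2 : (n : ℝ) / (2 * Real.pi) ≤ n / 6 :=
    div_le_div_of_nonneg_left (by positivity) (by norm_num) (by linarith)
  refine (mul_le_mul h2 h1 (abs_nonneg _) (by positivity)).trans ?_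
  have h3 : (n : ℝ) / 6 * ((10 / n) ^ 3 / 6) = 1000 / (36 * n ^ 2) := by
    field_simp
    norm_num
  rw [h3, div_le_div_iff₀ (by positivity) (by norm_num)]
  nlinarith

theorem abs_spread_sub_le (u w : Fin 2 → ℝ) (h : ∀ i, |u i - w i| ≤ 1 / 32) :
    |spread (Fin 2) u - spread (Fin 2) w| ≤ 1 / 16 := by
  refine (abs_sub_map_le_sub (spread (Fin 2)) u w).trans ((spread_le_two_mul_norm _).trans ?_)
  have : ‖u - w‖ ≤ 1 / 32 := (pi_norm_le_iff_of_nonneg (by norm_num)).2 h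
  linarith

theorem abs_arg_lt_of_tent_pos (hn : 0 < n) {v : GridPoint n} {x : EuclideanSpace ℝ (Fin 4)}
    (h : 0 < tent v x) (i : Fin 2) :
    |Complex.arg (cpx x i * ((v.1 i)⁻¹ : Circle))| < 2 * Real.pi / n := by
  have hn' : (0 : ℝ) < n := by exact_mod_cast hn
  have hpi := Real.pi_pos
  have h1 := (abs_le_spread _ i).trans_lt (tent_pos_iff.1 h)
  rw [relPos_eq, abs_mul, abs_of_nonneg (by positivity), div_mul_eq_mul_div,
    div_lt_one (by positivity)] at h1
  rw [lt_div_iff₀ hn']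
  linarith

theorem dist_lt_of_tent_pos (hn : 0 < n) {v : GridPoint n} {x : EuclideanSpace ℝ (Fin 4)}
    (hx : x ∈ T2) (h : 0 < tent v x) : dist x (ofCircle v.1) < 10 / n := by
  have hn' : (0 : ℝ) < n := by exact_mod_cast hn
  -- A chord is no longer than its arc, which is below `2 * π / n`; two such factors give `√98 / n <
  -- 10 / n`.
  have hi : ∀ i, ‖cpx (x - ofCircle v.1) i‖ ≤ 7 / n := fun i => by
    obtain ⟨c, hc⟩ := exists_circle_eq hx
    have h1 := abs_arg_lt_of_tent_pos hn h i
    rw [hc, ← Circle.coe_mul] at h1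
    have h2 : cpx (x - ofCircle v.1) i = ((c i * (v.1 i)⁻¹ : Circle) - 1) * (v.1 i : ℂ) := by
      rw [cpx_sub, cpx_ofCircle, hc, sub_mul, one_mul, ← Circle.coe_mul, inv_mul_cancel_right]
    rw [h2, norm_mul, Circle.norm_coe, mul_one, ← Circle.exp_arg (c i * (v.1 i)⁻¹),
      Circle.coe_exp, mul_comm]
    refine Real.norm_exp_I_mul_ofReal_sub_one_le.trans (h1.le.trans ?_)
    have := Real.pi_lt_d2
    exact div_le_div_of_nonneg_right (by linarith) hn'.le
  refine (pow_lt_pow_iff_left₀ dist_nonneg (by positivity) two_ne_zero).1 ?_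
  rw [dist_eq_norm, norm_sq_eq]
  have h0 := pow_le_pow_left₀ (norm_nonneg _) (hi 0) 2
  have h1 := pow_le_pow_left₀ (norm_nonneg _) (hi 1) 2
  have h2 : (0 : ℝ) < (1 / n) ^ 2 := by positivity
  have e1 : (7 / (n : ℝ)) ^ 2 = 49 * (1 / n) ^ 2 := by ring
  have e2 : (10 / (n : ℝ)) ^ 2 = 100 * (1 / n) ^ 2 := by ring
  rw [e1] at h0 h1
  rw [e2]
  linarith

/-- Concave functions on Euclidean space whose common positivity characterises, on the torus, a
neighbourhood of the cell of `v` in its open star. -/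
noncomputable def bound (v : GridPoint n) : Option (Fin 2) → EuclideanSpace ℝ (Fin 4) → ℝ
  | none, x => 15 / 16 - spread (Fin 2) (sinePos v x)
  | some i, x => cosine v i x

theorem concaveOn_bound (v : GridPoint n) (k : Option (Fin 2)) :
    ConcaveOn ℝ univ (bound v k) := by
  cases k with
  | none =>
    have h := (spread (Fin 2)).convexOn.comp_linearMap (sinePos v)
    exact (concaveOn_const _ convex_univ).sub h
  | some i => exact (cosine v i).concaveOn convex_univ

theorem bound_sub_le (hn : 0 < n) (v : GridPoint n) (k : Option (Fin 2))
    (x y : EuclideanSpace ℝ (Fin 4)) : bound v k x - bound v k y ≤ n * dist x y := by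
  cases k with
  | none =>
    have h1 := map_add_le_add (spread (Fin 2)) (sinePos v x) (sinePos v y - sinePos v x)
    rw [add_sub_cancel, ← map_sub] at h1
    have h2 := spread_sinePos_le v (y - x)
    rw [← dist_eq_norm, dist_comm] at h2
    simp only [bound]
    linarith
  | some i =>
    simp only [bound]
    rw [← map_sub, dist_eq_norm]
    have hn' : (1 : ℝ) ≤ n := by exact_mod_cast hn
    refine (le_abs_self _).trans ((abs_cosine_le v i _).trans ?_)
    exact le_mul_of_one_le_left (norm_nonneg _) hn'

/-- On the cell the spread of the angles is at most `3 / 4`; linearisation costs `1 / 16`, leaving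
`15 / 16 - 13 / 16 = 1 / 8`. The cosines are close to one. -/
theorem le_bound (hn : 100 ≤ n) (v : GridPoint n) (k : Option (Fin 2))
    {x : EuclideanSpace ℝ (Fin 4)} (hx : x ∈ T2) (h : 1 / 4 ≤ tent v x) : 1 / 8 ≤ bound v k x := by
  have hn' : (100 : ℝ) ≤ n := by exact_mod_cast hn
  have harg : ∀ i, |Complex.arg (cpx x i * ((v.1 i)⁻¹ : Circle))| ≤ 10 / n := fun i => by
    have := Real.pi_lt_d2
    exact (abs_arg_lt_of_tent_pos (by omega) (by linarith) i).le.trans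
      (div_le_div_of_nonneg_right (by linarith) (by linarith))
  cases k with
  | none =>
    have h1 := (le_max_iff.1 h).resolve_right (by norm_num)
    have h2 := abs_le.1 (abs_spread_sub_le _ _ fun i => abs_relPos_sub_sinePos_le hn v hx (harg i))
    simp only [bound]
    linarith
  | some i =>
    have h1 : |Complex.arg (cpx x i * ((v.1 i)⁻¹ : Circle))| ≤ 1 / 10 := (harg i).trans (by
      rw [div_le_div_iff₀ (by linarith) (by norm_num)]
      linarith)
    have h2 := Real.one_sub_sq_div_two_le_cos
      (x := Complex.arg (cpx x i * ((v.1 i)⁻¹ : Circle)))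
    have h3 := pow_le_pow_left₀ (abs_nonneg _) h1 2
    rw [sq_abs] at h3
    simp only [bound]
    rw [cosine_eq v hx]
    rw [show ((1 : ℝ) / 10) ^ 2 = 1 / 100 by norm_num] at h3
    linarith

/-- A small sine also occurs near the opposite point; a positive cosine rules this out. Jordan's
inequality then bounds the angle by `10 / n`, and the linearisation error `1 / 16` is exactly what
the threshold `15 / 16` leaves. -/
theorem tent_pos_of_bound_pos (hn : 100 ≤ n) (v : GridPoint n) {x : EuclideanSpace ℝ (Fin 4)}
    (hx : x ∈ T2) (h : ∀ k, 0 < bound v k x) : 0 < tent v x := by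
  have hn' : (100 : ℝ) ≤ n := by exact_mod_cast hn
  have hpi := Real.pi_pos
  have hpi2 := Real.pi_lt_d2
  have h0 : spread (Fin 2) (sinePos v x) < 15 / 16 := sub_pos.1 (h none)
  have harg : ∀ i, |Complex.arg (cpx x i * ((v.1 i)⁻¹ : Circle))| ≤ 10 / n := fun i => by
    have h1 := Real.mul_abs_le_abs_sin (Complex.abs_arg_le_pi_div_two_iff.2 (h (some i)).le)
    have h2 := (abs_le_spread _ i).trans_lt h0
    rw [sinePos_eq v hx, abs_mul, abs_of_nonneg (by positivity)] at h2
    have h3 := (mul_le_mul_of_nonneg_left h1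
      (show 0 ≤ (n : ℝ) / (2 * Real.pi) by positivity)).trans_lt h2
    rw [← mul_assoc, show (n : ℝ) / (2 * Real.pi) * (2 / Real.pi) = n / Real.pi ^ 2 by field_simp,
      div_mul_eq_mul_div, div_lt_iff₀ (by positivity)] at h3
    rw [le_div_iff₀ (by linarith)]
    nlinarith
  have h2 := abs_le.1 (abs_spread_sub_le _ _ fun i => abs_relPos_sub_sinePos_le hn v hx (harg i))
  rw [tent_pos_iff]
  linarith

theorem isNicelyTriangulable : IsNicelyTriangulable T2 := by
  -- `ρ < 1 / 10` forces `n > 100`, as linearisation requires; with `n * ρ ≤ 11`, `L * δ ≤ 11 / 100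
  -- < 1 / 8`.
  refine ⟨1 / 10, by norm_num, 1 / 100, by norm_num, fun ρ hρ hρ1 => ?_⟩
  obtain ⟨n, hn1, hn2⟩ : ∃ n : ℕ, 10 / ρ < n ∧ (n : ℝ) ≤ 11 / ρ := by
    refine ⟨⌊10 / ρ⌋₊ + 1, by exact_mod_cast Nat.lt_floor_add_one (10 / ρ), ?_⟩
    have h1 := Nat.floor_le (show 0 ≤ 10 / ρ by positivity)
    have h2 : 1 ≤ 1 / ρ := by rw [le_div_iff₀ hρ]; linarith
    have h3 : 11 / ρ = 10 / ρ + 1 / ρ := by ring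
    push_cast
    linarith
  rw [div_lt_iff₀ hρ] at hn1
  rw [le_div_iff₀ hρ] at hn2
  have hn100 : (100 : ℝ) < n := by nlinarith
  have hn : 100 ≤ n := by exact_mod_cast hn100.le
  have H := tentFamily (by omega : 8 ≤ n)
  refine ⟨GridPoint n, H.complex, H.homeomorph.symm, TentFamily.cell T2 _,
    H.isNiceTriangulation (c := 1 / 8) (L := n) (κ := fun _ => Option (Fin 2)) hρ (by positivity)
      (by linarith) (fun v => ofCircle v.1) (fun v => ofCircle_mem v.1) (fun v => tent_self v)
      (fun v x hx h => (dist_lt_of_tent_pos (by omega) hx h).trans ?_) bound concaveOn_bound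
      (bound_sub_le (by omega)) (by positivity)
      (fun v k x hx h => le_bound hn v k hx (by exact_mod_cast h))
      (fun v x hx h => tent_pos_of_bound_pos hn v hx h)⟩
  rw [div_lt_iff₀ (by linarith)]
  linarith

end FlatTorus

theorem mainTheorem9 :
    IsNicelyTriangulable {x : EuclideanSpace ℝ (Fin 3) | ∑ i, x i ^ 2 = 1} ∧
    IsNicelyTriangulable
      {x : EuclideanSpace ℝ (Fin 4) | x 0 ^ 2 + x 1 ^ 2 = 1 ∧ x 2 ^ 2 + x 3 ^ 2 = 1} ∧
    (∀ (m d : ℕ) (φ : EuclideanSpace ℝ (Fin m) →ᵃⁱ[ℝ] EuclideanSpace ℝ (Fin d)),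
      IsNicelyTriangulable (Set.range φ)) :=
  ⟨UnitSphere.isNicelyTriangulable, FlatTorus.isNicelyTriangulable,
    fun _ _ φ => EuclideanSpace.isNicelyTriangulable_range φ⟩
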